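/- **Theorem 3.7** (Intrinsic transverse phase of a Gaussian beam, 2-d case). Let $D\subseteq\mathbb R$ be open and let $c: D\to(0,\infty)$ be a $C^3$ sound speed profile. On $\{(r,z): z\in D\}$ consider the Fermat metric $g=c(z)^{-2}(dr^2+dz^2)$, whose geodesics are the solutions of $$\ddot r-2\frac{c'}{c}\,\dot r\dot z=0,\qquad \ddot z+\frac{c'}{c}\,(\dot r^2-\dot z^2)=0,$$ and whose Gaussian curvature is $K=cc''-(c')^2$. Fix $z_0\in D$ and, for $\theta$ in a neighbourhood of $\theta_0$, let $\mathbf x(t;\theta)=(r(t;\theta),z(t;\theta))$, $0\le t\le t_1$, be the ray (geodesic, parameterized by travel time $t$) with $\mathbf x(0;\theta)=(0,z_0)$ and $\dot{\mathbf x}(0;\theta)=c(z_0)(\cos\theta,-\sin\theta)$. Let $a$ be the solution on $[0,t_1]$ of Jacobi's equation along the ray $\mathbf x(\cdot;\theta_0)$, $$\ddot a+K\big(z(t;\theta_0)\big)\,a=0,\qquad a(0)=0,\quad \dot a(0)=1,$$ and let $0<t<t_1$ with $a(t)\ne0$. Then: 1. The travel time of the beam is well defined near $\mathbf x(t;\theta_0)$: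 there is a real-valued function $T$ on the $(r,z)$-plane with $T(\mathbf x(\tau;\theta))=\tau$ for all $(\tau,\theta)$ sufficiently close to $(t,\theta_0)$, and any two such functions agree in a neighbourhood of $\mathbf x(t;\theta_0)$. 2. Let $\sigma(\delta\mu)$ be a geodesic of $g$, defined for $\delta\mu$ in an open interval around $0$, with $\sigma(0)=\mathbf x(t;\theta_0)$, $g(\sigma'(0),\sigma'(0))=1$ and $g(\dot{\mathbf x}(t;\theta_0),\sigma'(0))=0$, so that $|\delta\mu|$ is intrinsic distance along the transverse geodesic normal to the ray. Let $\delta t_{\rm i}(\delta\mu)=T(\sigma(\delta\mu))-t$ be the travel-time difference between the point $\sigma(\delta\mu)$ and the wavefront of constant travel time $t$ through $\mathbf x(t;\theta_0)$. Then $$\delta t_{\rm i}(\delta\mu)=\frac12\,\frac{\dot a(t)}{a(t)}\,\delta\mu^2+O(\delta\mu^3)\qquad\text{as }\delta\mu\to0 .$$ -/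

import Mathlib

open Set Filter Topology Asymptotics

noncomputable section

namespace GaussianBeam

/-- The Fermat metric `c(z)⁻² (dr² + dz²)` of a horizontally stratified medium, at the point
`x = (r, z)`, evaluated on the tangent vectors `u` and `v` (components in the `(r, z)`-plane). -/
def fermat (c : ℝ → ℝ) (x u v : ℝ × ℝ) : ℝ :=
  (c x.2 ^ 2)⁻¹ * (u.1 * v.1 + u.2 * v.2)

/-- The acceleration `ẍᵏ = -∑ Γᵏᵢⱼ ẋⁱ ẋʲ` prescribed at the point `x = (r, z)` and the velocity
`v = (ṙ, ż)` by the geodesic (ray) equations of the Fermat metric,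
`r̈ - 2 (c'/c) ṙ ż = 0` and `z̈ + (c'/c) (ṙ² - ż²) = 0`. -/
def rayAcceleration (c : ℝ → ℝ) (x v : ℝ × ℝ) : ℝ × ℝ :=
  (2 * (deriv c x.2 / c x.2) * (v.1 * v.2),
    -(deriv c x.2 / c x.2) * (v.1 ^ 2 - v.2 ^ 2))

/-- The curve `x`, with velocity `v`, is on the parameter set `I` an (affinely parameterized)
geodesic of the Fermat metric that stays in the medium, which occupies the depths `z ∈ D`. -/
structure IsFermatGeodesic (c : ℝ → ℝ) (D I : Set ℝ) (x v : ℝ → ℝ × ℝ) : Prop where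
  mem : ∀ t ∈ I, (x t).2 ∈ D
  velocity : ∀ t ∈ I, HasDerivWithinAt x (v t) I t
  acceleration : ∀ t ∈ I, HasDerivWithinAt v (rayAcceleration c (x t) (v t)) I t

/-- `X t θ = x(t; θ)` is the fan of rays, parameterized by the travel time `t ∈ [0, t₁]` and by
the initial elevation angle `θ ∈ Θ`, that leave the source `(0, z₀)` with the initial velocity
`c(z₀) (cos θ, -sin θ)`; `V t θ` is the velocity of the ray. -/
structure IsRayFan (c : ℝ → ℝ) (D : Set ℝ) (z₀ t₁ : ℝ) (Θ : Set ℝ)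
    (X V : ℝ → ℝ → ℝ × ℝ) : Prop where
  ray : ∀ θ ∈ Θ, IsFermatGeodesic c D (Icc 0 t₁) (fun t => X t θ) (fun t => V t θ)
  source : ∀ θ ∈ Θ, X 0 θ = (0, z₀)
  direction : ∀ θ ∈ Θ, V 0 θ = (c z₀ * Real.cos θ, -(c z₀ * Real.sin θ))

/-- The Gaussian curvature `K = c c'' - (c')²` of the Fermat metric at depth `z`. -/
def gaussCurvature (c : ℝ → ℝ) (z : ℝ) : ℝ :=
  c z * deriv (deriv c) z - deriv c z ^ 2

/-- `a`, with derivative `a'`, solves Jacobi's equation `ä + K a = 0`, `a(0) = 0`, `ȧ(0) = 1`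
along the curve `x` for the times `t ∈ [0, t₁]`. -/
structure IsJacobiSolution (c : ℝ → ℝ) (t₁ : ℝ) (x : ℝ → ℝ × ℝ) (a a' : ℝ → ℝ) : Prop where
  hasDeriv : ∀ t ∈ Icc 0 t₁, HasDerivWithinAt a (a' t) (Icc 0 t₁) t
  hasDeriv' : ∀ t ∈ Icc 0 t₁,
    HasDerivWithinAt a' (-(gaussCurvature c (x t).2 * a t)) (Icc 0 t₁) t
  zero : a 0 = 0
  zero' : a' 0 = 1

/-- `T` is, near the point `X t₀ θ₀`, the travel time of the beam around the ray with elevation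
angle `θ₀`: a point reached at time `t` by a ray of elevation angle `θ`, where `(t, θ)` is close
to `(t₀, θ₀)`, has travel time `t`. So near `X t₀ θ₀` the wavefronts of the beam are the level
sets of `T`, that through `X t₀ θ₀` being `T = t₀`. -/
def IsBeamTravelTime (X : ℝ → ℝ → ℝ × ℝ) (t₀ θ₀ : ℝ) (T : ℝ × ℝ → ℝ) : Prop :=
  ∀ᶠ p : ℝ × ℝ in 𝓝 (t₀, θ₀), T (X p.1 p.2) = p.1

end GaussianBeam

end

/-!
The geodesics of the Fermat metric are, in the phase space of pairs `(x, e)` with `e = ẋ / c`, the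
integral curves of a vector field `phaseField c` that is `C²` because `c` is `C³`. The argument is a
calculation with first-order expansions and quadratic remainders for the fan of rays `Y t θ` in
phase space, and it proceeds from two estimates.

* Dependence on `θ`. Grönwall's inequality, applied to `Y t θ' - Y t θ - (θ' - θ) J t`, where
  `J` solves the linearized equation along the central ray, shows that the fan is strictly
  differentiable in `(t, θ)` at `(t₀, θ₀)`, with a quadratic remainder
  (`exists_norm_sub_sub_smul_le`, `isBigO_sub_sub_of_solutions`). The field `J` need not be
  constructed by an existence theorem: it is `jacobiField`, written in terms of the given `a`. Its
  position component is `a c e^⊥`, so for `a t₀ ≠ 0` the derivative of the map `(t, θ) ↦ X t θ` is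
  invertible; by the inverse function theorem `(t, θ)` are local coordinates, and `t` is the travel
  time `T` (`isBeamTravelTime_localInverse`).

* The eikonal equation `∇T = e / c`. For two rays of the fan, the slowness `e / c` of the first,
  applied to the chord between the two points reached at the same time, vanishes at the source, and
  its time derivative is of second order in the distance of the rays. This is the Gauss lemma, and
  it yields `isBigO_slowness_sub_sub`, from which `T` can be differentiated at all points close to
  `X t₀ θ₀`, even though the fan is only known to be differentiable at `(t₀, θ₀)` itself.

So `T ∘ σ` has the derivative `⟨e, f⟩`, where `e` is the ray direction at `σ μ` and `f = σ' / c` is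
the direction of `σ`. Both are known to first order at `μ = 0`, the former through `J` and the
latter from the geodesic equation. The derivative therefore equals `(a'/a) μ + O(μ²)`
(`isBigO_slowness_sub`): the two contributions of `c'` cancel, as `σ` is a geodesic. Integration
gives the theorem.
-/

namespace GaussianBeam

/-! ### Ordinary differential equations: dependence of solutions on a parameter -/

section Flow

variable {E G : Type*} [NormedAddCommGroup E] [NormedSpace ℝ E]
  [NormedAddCommGroup G] [NormedSpace ℝ G]

/-- A `C²` map has, on balls of a fixed radius around the points of a compact set, a uniform
bound for its values, its derivative, and the Lipschitz constants of both. -/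
lemma exists_uniform_bounds [ProperSpace E] {f : E → G} {K U : Set E} (hK : IsCompact K)
    (hU : IsOpen U) (hKU : K ⊆ U) (hf : ContDiffOn ℝ 2 f U) :
    ∃ ρ > 0, ∃ M : ℝ, 1 ≤ M ∧ ∀ x ∈ K, ∀ y ∈ Metric.closedBall x ρ,
      y ∈ U ∧ ‖f y‖ ≤ M ∧ ∀ y' ∈ Metric.closedBall x ρ,
        ‖f y' - f y‖ ≤ M * ‖y' - y‖ ∧ ‖fderiv ℝ f y' - fderiv ℝ f y‖ ≤ M * ‖y' - y‖ := by
  obtain ⟨ρ, hρ, hsub⟩ := hK.exists_cthickening_subset_open hU hKU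
  have hcpt : IsCompact (Metric.cthickening ρ K) := hK.cthickening
  have hf' : ContDiffOn ℝ 1 (fderiv ℝ f) U := hf.fderiv_of_isOpen hU (by norm_num)
  have hf'' : ContDiffOn ℝ 0 (fderiv ℝ (fderiv ℝ f)) U := hf'.fderiv_of_isOpen hU (by norm_num)
  obtain ⟨M₀, h₀⟩ := hcpt.exists_bound_of_continuousOn (hf.continuousOn.mono hsub)
  obtain ⟨M₁, h₁⟩ := hcpt.exists_bound_of_continuousOn (hf'.continuousOn.mono hsub)
  obtain ⟨M₂, h₂⟩ : ∃ M₂, ∀ x ∈ Metric.cthickening ρ K, ‖fderiv ℝ (fderiv ℝ f) x‖ ≤ M₂ :=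
    hcpt.exists_bound_of_continuousOn (E := E →L[ℝ] E →L[ℝ] G) (hf''.continuousOn.mono hsub)
  refine ⟨ρ, hρ, max 1 (max M₀ (max M₁ M₂)), le_max_left _ _, fun x hx y hy => ?_⟩
  have hball : Metric.closedBall x ρ ⊆ Metric.cthickening ρ K :=
    Metric.closedBall_subset_cthickening hx ρ
  refine ⟨hsub (hball hy), (h₀ y (hball hy)).trans (by simp), fun y' hy' => ⟨?_, ?_⟩⟩
  · exact (convex_closedBall x ρ).norm_image_sub_le_of_norm_fderiv_le
      (fun z hz => (hf.differentiableOn (by norm_num)).differentiableAt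
        (hU.mem_nhds (hsub (hball hz))))
      (fun z hz => (h₁ z (hball hz)).trans (by simp)) hy hy'
  · exact (convex_closedBall x ρ).norm_image_sub_le_of_norm_fderiv_le
      (fun z hz => (hf'.differentiableOn (by norm_num)).differentiableAt
        (hU.mem_nhds (hsub (hball hz))))
      (fun z hz => (h₂ z (hball hz)).trans (by simp)) hy hy'

/-- The first-order Taylor formula with quadratic remainder for a `C²` map, uniform near a compact
set. -/
lemma exists_uniform_taylor_bound [ProperSpace E] {f : E → G} {K U : Set E}
    (hK : IsCompact K) (hU : IsOpen U) (hKU : K ⊆ U) (hf : ContDiffOn ℝ 2 f U) :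
    ∃ ρ > 0, ∃ M : ℝ, 1 ≤ M ∧ ∀ x ∈ K, ∀ y ∈ Metric.closedBall x ρ, ‖f y‖ ≤ M ∧
      ∀ y' ∈ Metric.closedBall x ρ, ‖f y' - f y‖ ≤ M * ‖y' - y‖ ∧
        ‖f y' - f y - fderiv ℝ f y (y' - y)‖ ≤ M * ‖y' - y‖ ^ 2 := by
  obtain ⟨ρ, hρ, M, hM, h⟩ := exists_uniform_bounds hK hU hKU hf
  refine ⟨ρ, hρ, M, hM, fun x hx y hy => ⟨(h x hx y hy).2.1, fun y' hy' =>
    ⟨((h x hx y hy).2.2 y' hy').1, ?_⟩⟩⟩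
  have hseg : segment ℝ y y' ⊆ Metric.closedBall x ρ :=
    (convex_closedBall x ρ).segment_subset hy hy'
  have := (convex_segment y y').norm_image_sub_le_of_norm_fderiv_le' (f := f)
    (φ := fderiv ℝ f y) (C := M * ‖y' - y‖)
    (fun z hz => (hf.differentiableOn (by norm_num)).differentiableAt
      (hU.mem_nhds (h x hx z (hseg hz)).1))
    (fun z hz => by
      refine ((h x hx y hy).2.2 z (hseg hz)).2.trans ?_
      gcongr
      exact norm_sub_le_of_mem_segment hz)
    (left_mem_segment ℝ y y') (right_mem_segment ℝ y y')
  refine this.trans (le_of_eq ?_)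
  ring

/-- Grönwall's inequality, in a form convenient for a rate `K ≥ 1`. -/
lemma norm_le_mul_exp_of_norm_deriv_le {f f' : ℝ → E} {b K ε : ℝ} (hK : 1 ≤ K) (hε : 0 ≤ ε)
    (hf : ∀ t ∈ Icc 0 b, HasDerivWithinAt f (f' t) (Icc 0 b) t)
    (bound : ∀ t ∈ Ico 0 b, ‖f' t‖ ≤ K * ‖f t‖ + ε) :
    ∀ t ∈ Icc 0 b, ‖f t‖ ≤ (‖f 0‖ + ε) * Real.exp (K * b) := by
  intro t ht
  have h := norm_le_gronwallBound_of_norm_deriv_right_le (f := f) (f' := f') (δ := ‖f 0‖)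
    (fun s hs => (hf s hs).continuousWithinAt)
    (fun s hs => (hf s (Ico_subset_Icc_self hs)).mono_of_mem_nhdsWithin
      (Icc_mem_nhdsGE_of_mem hs)) le_rfl bound t ht
  have hK0 : (0 : ℝ) < K := by linarith
  rw [gronwallBound_of_K_ne_0 hK0.ne', sub_zero] at h
  have h1 : Real.exp (K * t) ≤ Real.exp (K * b) :=
    Real.exp_le_exp.2 (mul_le_mul_of_nonneg_left ht.2 hK0.le)
  have h2 : ε / K ≤ ε := div_le_self hε hK
  have h3 : 1 ≤ Real.exp (K * t) := Real.one_le_exp (mul_nonneg hK0.le ht.1)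
  calc ‖f t‖ ≤ ‖f 0‖ * Real.exp (K * t) + ε / K * (Real.exp (K * t) - 1) := h
    _ ≤ ‖f 0‖ * Real.exp (K * t) + ε * Real.exp (K * t) := by
        gcongr
        linarith
    _ = (‖f 0‖ + ε) * Real.exp (K * t) := by ring
    _ ≤ _ := by gcongr

/-- Two solutions of an autonomous equation, the first of them the centre of a tube of radius `ρ`
on which the right-hand side is Lipschitz: if the second starts close enough, it never leaves the
tube. -/
lemma norm_sub_lt_of_solutions {F : E → E} {y₀ y : ℝ → E} {b K ρ : ℝ} (hK : 1 ≤ K)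
    (hy₀ : ∀ t ∈ Icc 0 b, HasDerivWithinAt y₀ (F (y₀ t)) (Icc 0 b) t)
    (hy : ∀ t ∈ Icc 0 b, HasDerivWithinAt y (F (y t)) (Icc 0 b) t)
    (hF : ∀ t ∈ Icc 0 b, ∀ x ∈ Metric.closedBall (y₀ t) ρ, ‖F x - F (y₀ t)‖ ≤ K * ‖x - y₀ t‖)
    (h0 : ‖y 0 - y₀ 0‖ * Real.exp (K * b) < ρ) :
    ∀ t ∈ Icc 0 b, ‖y t - y₀ t‖ < ρ := by
  by_contra! hcon
  have hcont : ContinuousOn (fun t => ‖y t - y₀ t‖) (Icc 0 b) := fun t ht =>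
    ((hy t ht).continuousWithinAt.sub (hy₀ t ht).continuousWithinAt).norm
  have hcpt : IsCompact (Icc 0 b ∩ (fun t => ‖y t - y₀ t‖) ⁻¹' Ici ρ) :=
    isCompact_Icc.of_isClosed_subset (hcont.preimage_isClosed_of_isClosed isClosed_Icc isClosed_Ici)
      inter_subset_left
  -- `m` is the first time at which the boundary of the tube is reached
  obtain ⟨m, ⟨hm, hmρ⟩, hmin⟩ :=
    hcpt.exists_isLeast (let ⟨t, ht, h⟩ := hcon; ⟨t, ht, h⟩)
  have hsub : Icc 0 m ⊆ Icc 0 b := Icc_subset_Icc_right hm.2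
  have hlt : ∀ t ∈ Ico 0 m, ‖y t - y₀ t‖ < ρ := by
    intro t ht
    by_contra! h
    exact absurd (hmin ⟨hsub (Ico_subset_Icc_self ht), h⟩) (not_le.2 ht.2)
  have h := norm_le_mul_exp_of_norm_deriv_le (f := fun t => y t - y₀ t) hK le_rfl
    (fun t ht => ((hy t (hsub ht)).sub (hy₀ t (hsub ht))).mono hsub)
    (fun t ht => by
      rw [add_zero]
      exact hF t (hsub (Ico_subset_Icc_self ht)) _ (by
        rw [mem_closedBall_iff_norm]; exact (hlt t ht).le)) m ⟨hm.1, le_rfl⟩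
  rw [add_zero] at h
  have h1 : Real.exp (K * m) ≤ Real.exp (K * b) :=
    Real.exp_le_exp.2 (mul_le_mul_of_nonneg_left hm.2 (by linarith))
  have h2 := mul_le_mul_of_nonneg_left h1 (norm_nonneg (y 0 - y₀ 0))
  have h3 : ρ ≤ ‖y m - y₀ m‖ := hmρ
  linarith

/-- Differentiable dependence on a parameter `θ`, at one solution `Y · θ₀`, of the solutions of an
autonomous equation with `C²` right-hand side. The solution `J` of the linearized equation is given,
and the remainder in the strict differentiability statement is quadratic, uniformly in time. -/
lemma exists_norm_sub_sub_smul_le [ProperSpace E] {F : E → E} {U : Set E} (hU : IsOpen U)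
    (hF : ContDiffOn ℝ 2 F U) {Y : ℝ → ℝ → E} {J : ℝ → E} {b θ₀ : ℝ} {Θ : Set ℝ} (hb : 0 ≤ b)
    (hΘ : Θ ∈ 𝓝 θ₀)
    (hY : ∀ θ ∈ Θ, ∀ t ∈ Icc 0 b,
      HasDerivWithinAt (fun t => Y t θ) (F (Y t θ)) (Icc 0 b) t)
    (hYU : ∀ t ∈ Icc 0 b, Y t θ₀ ∈ U)
    (hJ : ∀ t ∈ Icc 0 b, HasDerivWithinAt J (fderiv ℝ F (Y t θ₀) (J t)) (Icc 0 b) t)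
    (hinit : ∃ C, ∀ θ ∈ Θ, ∀ θ' ∈ Θ, ‖Y 0 θ' - Y 0 θ - (θ' - θ) • J 0‖
      ≤ C * (|θ - θ₀| + |θ' - θ₀|) * |θ' - θ|) :
    ∃ C ≥ 0, ∃ r > 0, Metric.ball θ₀ r ⊆ Θ ∧
      ∀ θ ∈ Metric.ball θ₀ r, ∀ θ' ∈ Metric.ball θ₀ r, ∀ t ∈ Icc 0 b,
        ‖Y t θ' - Y t θ‖ ≤ C * |θ' - θ| ∧
        ‖Y t θ' - Y t θ - (θ' - θ) • J t‖ ≤ C * (|θ - θ₀| + |θ' - θ₀|) * |θ' - θ| := by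
  have hθ₀ : θ₀ ∈ Θ := mem_of_mem_nhds hΘ
  have hcont₀ : ContinuousOn (fun t => Y t θ₀) (Icc 0 b) := fun t ht =>
    (hY θ₀ hθ₀ t ht).continuousWithinAt
  obtain ⟨ρ, hρ, K, hK, hbd⟩ := exists_uniform_bounds
    (isCompact_Icc.image_of_continuousOn hcont₀) hU (image_subset_iff.2 hYU) hF
  replace hbd : ∀ t ∈ Icc 0 b, ∀ y ∈ Metric.closedBall (Y t θ₀) ρ,
      y ∈ U ∧ ‖F y‖ ≤ K ∧ ∀ y' ∈ Metric.closedBall (Y t θ₀) ρ,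
        ‖F y' - F y‖ ≤ K * ‖y' - y‖ ∧ ‖fderiv ℝ F y' - fderiv ℝ F y‖ ≤ K * ‖y' - y‖ :=
    fun t ht => hbd _ (mem_image_of_mem _ ht)
  have hK0 : 0 ≤ K := by linarith
  obtain ⟨C₀, hC₀⟩ := hinit
  obtain ⟨r₁, hr₁, hr₁Θ⟩ := Metric.mem_nhds_iff.1 hΘ
  set A := Real.exp (K * b) with hA
  have hA1 : 1 ≤ A := Real.one_le_exp (mul_nonneg hK0 hb)
  have hA0 : 0 < A := by linarith
  -- Lipschitz constant of the initial data
  set C₁ := |C₀| * 2 + ‖J 0‖ with hC₁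
  have hC₁0 : 0 ≤ C₁ := by positivity
  set r := min r₁ (min 1 (ρ / (C₁ * A + 1))) with hr
  have hr0 : 0 < r := by positivity
  have hball : Metric.ball θ₀ r ⊆ Θ :=
    (Metric.ball_subset_ball (min_le_left _ _)).trans hr₁Θ
  have hC₀' : ∀ θ ∈ Metric.ball θ₀ r, ∀ θ' ∈ Metric.ball θ₀ r,
      ‖Y 0 θ' - Y 0 θ - (θ' - θ) • J 0‖ ≤ |C₀| * (|θ - θ₀| + |θ' - θ₀|) * |θ' - θ| := by
    intro θ hθ θ' hθ'
    exact (hC₀ θ (hball hθ) θ' (hball hθ')).trans (by gcongr; exact le_abs_self _)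
  have hLip0 : ∀ θ ∈ Metric.ball θ₀ r, ∀ θ' ∈ Metric.ball θ₀ r,
      ‖Y 0 θ' - Y 0 θ‖ ≤ C₁ * |θ' - θ| := by
    intro θ hθ θ' hθ'
    have h1 := hC₀' θ hθ θ' hθ'
    have hr1 : r ≤ 1 := (min_le_right _ _).trans (min_le_left _ _)
    have h2 : |θ - θ₀| ≤ 1 := by rw [Metric.mem_ball, Real.dist_eq] at hθ; linarith
    have h3 : |θ' - θ₀| ≤ 1 := by rw [Metric.mem_ball, Real.dist_eq] at hθ'; linarith
    calc ‖Y 0 θ' - Y 0 θ‖ = ‖(Y 0 θ' - Y 0 θ - (θ' - θ) • J 0) + (θ' - θ) • J 0‖ := by simp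
      _ ≤ ‖Y 0 θ' - Y 0 θ - (θ' - θ) • J 0‖ + ‖(θ' - θ) • J 0‖ := norm_add_le _ _
      _ ≤ |C₀| * (1 + 1) * |θ' - θ| + |θ' - θ| * ‖J 0‖ := by
          rw [norm_smul, Real.norm_eq_abs]
          gcongr
          exact h1.trans (by gcongr)
      _ = C₁ * |θ' - θ| := by rw [hC₁]; ring
  have htube : ∀ θ ∈ Metric.ball θ₀ r, ∀ t ∈ Icc 0 b, ‖Y t θ - Y t θ₀‖ < ρ := by
    intro θ hθ
    refine norm_sub_lt_of_solutions hK (hY θ₀ hθ₀) (hY θ (hball hθ))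
      (fun t ht x hx => ((hbd t ht (Y t θ₀) (Metric.mem_closedBall_self hρ.le)).2.2 x hx).1) ?_
    have h1 := hLip0 θ₀ (Metric.mem_ball_self hr0) θ hθ
    have h2 : |θ - θ₀| < ρ / (C₁ * A + 1) := by
      rw [Metric.mem_ball, Real.dist_eq] at hθ
      exact hθ.trans_le ((min_le_right _ _).trans (min_le_right _ _))
    rw [lt_div_iff₀ (by positivity)] at h2
    calc ‖Y 0 θ - Y 0 θ₀‖ * A ≤ C₁ * |θ - θ₀| * A := by gcongr
      _ ≤ |θ - θ₀| * (C₁ * A + 1) := by nlinarith [abs_nonneg (θ - θ₀)]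
      _ < ρ := h2
  have hmem : ∀ θ ∈ Metric.ball θ₀ r, ∀ t ∈ Icc 0 b, Y t θ ∈ Metric.closedBall (Y t θ₀) ρ :=
    fun θ hθ t ht => by rw [mem_closedBall_iff_norm]; exact (htube θ hθ t ht).le
  have hLip : ∀ θ ∈ Metric.ball θ₀ r, ∀ θ' ∈ Metric.ball θ₀ r, ∀ t ∈ Icc 0 b,
      ‖Y t θ' - Y t θ‖ ≤ C₁ * A * |θ' - θ| := by
    intro θ hθ θ' hθ' t ht
    have h := norm_le_mul_exp_of_norm_deriv_le (f := fun t => Y t θ' - Y t θ) hK le_rfl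
      (fun t ht => (hY θ' (hball hθ') t ht).sub (hY θ (hball hθ) t ht))
      (fun s hs => by
        have hs' := Ico_subset_Icc_self hs
        rw [add_zero]
        exact ((hbd s hs' _ (hmem θ hθ s hs')).2.2 _ (hmem θ' hθ' s hs')).1) t ht
    rw [add_zero] at h
    calc _ ≤ ‖Y 0 θ' - Y 0 θ‖ * A := h
      _ ≤ C₁ * |θ' - θ| * A := by gcongr; exact hLip0 θ hθ θ' hθ'
      _ = _ := by ring
  obtain ⟨MJ, hMJ⟩ : ∃ MJ, ∀ t ∈ Icc 0 b, ‖fderiv ℝ F (Y t θ₀)‖ ≤ MJ := by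
    have hf' : ContDiffOn ℝ 1 (fderiv ℝ F) U := hF.fderiv_of_isOpen hU (by norm_num)
    exact isCompact_Icc.exists_bound_of_continuousOn (hf'.continuousOn.comp hcont₀ hYU)
  set K' := max 1 MJ
  set A' := Real.exp (K' * b)
  set C₂ := (|C₀| + K * (C₁ * A) * (C₁ * A)) * A' with hC₂
  have hC₂0 : 0 ≤ C₂ := by positivity
  refine ⟨C₁ * A + C₂, by positivity, r, hr0, hball, fun θ hθ θ' hθ' t ht => ⟨?_, ?_⟩⟩
  · refine (hLip θ hθ θ' hθ' t ht).trans ?_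
    gcongr
    linarith
  · set ε := K * (C₁ * A * (|θ - θ₀| + |θ' - θ₀|)) * (C₁ * A * |θ' - θ|) with hε
    have h := norm_le_mul_exp_of_norm_deriv_le
      (f := fun t => Y t θ' - Y t θ - (θ' - θ) • J t)
      (K := K') (ε := ε) (le_max_left _ _) (by positivity)
      (fun t ht => ((hY θ' (hball hθ') t ht).sub (hY θ (hball hθ) t ht)).sub
        ((hJ t ht).const_smul (θ' - θ)))
      (fun s hs => by
        have hs' := Ico_subset_Icc_self hs
        set m := max ‖Y s θ - Y s θ₀‖ ‖Y s θ' - Y s θ₀‖ with hm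
        have hmρ : m ≤ ρ := max_le (htube θ hθ s hs').le (htube θ' hθ' s hs').le
        have hsubρ := Metric.closedBall_subset_closedBall (x := Y s θ₀) hmρ
        -- the linearization at the central solution, on the smallest ball containing both others
        have h1 := (convex_closedBall (Y s θ₀) m).norm_image_sub_le_of_norm_fderiv_le'
          (f := F) (φ := fderiv ℝ F (Y s θ₀)) (C := K * m) (x := Y s θ) (y := Y s θ')
          (fun z hz => (hF.differentiableOn (by norm_num)).differentiableAt
            (hU.mem_nhds (hbd s hs' z (hsubρ hz)).1))
          (fun z hz => by
            refine ((hbd s hs' _ (Metric.mem_closedBall_self hρ.le)).2.2 z (hsubρ hz)).2.trans ?_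
            gcongr
            rwa [mem_closedBall_iff_norm] at hz)
          (by rw [mem_closedBall_iff_norm]; exact le_max_left _ _)
          (by rw [mem_closedBall_iff_norm]; exact le_max_right _ _)
        have hm' : m ≤ C₁ * A * (|θ - θ₀| + |θ' - θ₀|) := by
          have hθ₀' := Metric.mem_ball_self (x := θ₀) hr0
          refine max_le ((hLip θ₀ hθ₀' θ hθ s hs').trans ?_)
            ((hLip θ₀ hθ₀' θ' hθ' s hs').trans ?_)
          · gcongr
            linarith [abs_nonneg (θ' - θ₀)]
          · gcongr
            linarith [abs_nonneg (θ - θ₀)]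
        have h2 : F (Y s θ') - F (Y s θ) - (θ' - θ) • fderiv ℝ F (Y s θ₀) (J s)
            = fderiv ℝ F (Y s θ₀) (Y s θ' - Y s θ - (θ' - θ) • J s)
              + (F (Y s θ') - F (Y s θ) - fderiv ℝ F (Y s θ₀) (Y s θ' - Y s θ)) := by
          simp only [map_sub, map_smul]
          abel
        rw [h2]
        refine (norm_add_le _ _).trans (add_le_add ?_ ?_)
        · refine (ContinuousLinearMap.le_opNorm _ _).trans ?_
          gcongr
          exact (hMJ s hs').trans (le_max_right _ _)
        · refine h1.trans ?_
          rw [hε]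
          gcongr
          exact hLip θ hθ θ' hθ' s hs') t ht
    calc _ ≤ (‖Y 0 θ' - Y 0 θ - (θ' - θ) • J 0‖ + ε) * A' := h
      _ ≤ (|C₀| * (|θ - θ₀| + |θ' - θ₀|) * |θ' - θ| + ε) * A' := by
          gcongr
          exact hC₀' θ hθ θ' hθ'
      _ = C₂ * (|θ - θ₀| + |θ' - θ₀|) * |θ' - θ| := by rw [hε, hC₂]; ring
      _ ≤ _ := by
          gcongr
          nlinarith [mul_nonneg hC₁0 hA0.le]

/-- From differentiability in the parameter, uniformly in time, to joint strict differentiability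
in time and parameter, with a quadratic remainder. -/
lemma isBigO_sub_sub_of_solutions {F : E → E} {Y : ℝ → ℝ → E} {J : ℝ → E} {J' : E}
    {b t₀ θ₀ C r : ℝ} (ht₀ : t₀ ∈ Ioo 0 b) (hr : 0 < r)
    (hF : DifferentiableAt ℝ F (Y t₀ θ₀))
    (hY : ∀ θ ∈ Metric.ball θ₀ r, ∀ t ∈ Icc 0 b,
      HasDerivWithinAt (fun t => Y t θ) (F (Y t θ)) (Icc 0 b) t)
    (hJ : HasDerivAt J J' t₀)
    (hC : ∀ θ ∈ Metric.ball θ₀ r, ∀ θ' ∈ Metric.ball θ₀ r, ∀ t ∈ Icc 0 b,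
        ‖Y t θ' - Y t θ‖ ≤ C * |θ' - θ| ∧
        ‖Y t θ' - Y t θ - (θ' - θ) • J t‖ ≤ C * (|θ - θ₀| + |θ' - θ₀|) * |θ' - θ|) :
    (fun q : (ℝ × ℝ) × (ℝ × ℝ) => Y q.1.1 q.1.2 - Y q.2.1 q.2.2
        - ((q.1 - q.2).1 • F (Y t₀ θ₀) + (q.1 - q.2).2 • J t₀))
      =O[𝓝 ((t₀, θ₀), (t₀, θ₀))] fun q => ‖q - ((t₀, θ₀), (t₀, θ₀))‖ * ‖q.1 - q.2‖ := by
  have hθ₀ : θ₀ ∈ Metric.ball θ₀ r := Metric.mem_ball_self hr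
  have hI : Icc 0 b ∈ 𝓝 t₀ := Icc_mem_nhds ht₀.1 ht₀.2
  have hdom : ∀ᶠ p : ℝ × ℝ in 𝓝 (t₀, θ₀), p.1 ∈ Icc 0 b ∧ p.2 ∈ Metric.ball θ₀ r :=
    (continuous_fst.continuousAt.eventually_mem hI).and
      (continuous_snd.continuousAt.eventually_mem (Metric.ball_mem_nhds _ hr))
  have hfst : (fun p : ℝ × ℝ => p.1 - t₀) =O[𝓝 (t₀, θ₀)] fun p => p - (t₀, θ₀) :=
    IsBigO.of_bound 1 (Eventually.of_forall fun p => by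
      simpa using norm_fst_le (p - (t₀, θ₀)))
  have hsnd : (fun p : ℝ × ℝ => p.2 - θ₀) =O[𝓝 (t₀, θ₀)] fun p => p - (t₀, θ₀) :=
    IsBigO.of_bound 1 (Eventually.of_forall fun p => by
      simpa using norm_snd_le (p - (t₀, θ₀)))
  have htend : Tendsto (fun p : ℝ × ℝ => p.1) (𝓝 (t₀, θ₀)) (𝓝 t₀) :=
    continuous_fst.continuousAt
  have hYp : (fun p : ℝ × ℝ => Y p.1 p.2 - Y t₀ θ₀) =O[𝓝 (t₀, θ₀)] fun p => p - (t₀, θ₀) := by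
    have h1 : (fun p : ℝ × ℝ => Y p.1 p.2 - Y p.1 θ₀) =O[𝓝 (t₀, θ₀)] fun p => p - (t₀, θ₀) := by
      refine IsBigO.trans (IsBigO.of_bound C ?_) hsnd
      filter_upwards [hdom] with p hp
      exact (hC θ₀ hθ₀ p.2 hp.2 p.1 hp.1).1
    have h2 : (fun p : ℝ × ℝ => Y p.1 θ₀ - Y t₀ θ₀) =O[𝓝 (t₀, θ₀)] fun p => p - (t₀, θ₀) :=
      ((((hY θ₀ hθ₀ t₀ (mem_of_mem_nhds hI)).hasDerivAt hI).hasFDerivAt.isBigO_sub).comp_tendsto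
        htend).trans hfst
    simpa using h1.add h2
  have hYcont : Tendsto (fun p : ℝ × ℝ => Y p.1 p.2) (𝓝 (t₀, θ₀)) (𝓝 (Y t₀ θ₀)) := by
    rw [← tendsto_sub_nhds_zero_iff]
    refine hYp.trans_tendsto ?_
    rw [tendsto_sub_nhds_zero_iff]
    exact tendsto_id
  have hFp : (fun p : ℝ × ℝ => F (Y p.1 p.2) - F (Y t₀ θ₀)) =O[𝓝 (t₀, θ₀)]
      fun p => p - (t₀, θ₀) :=
    (hF.hasFDerivAt.isBigO_sub.comp_tendsto hYcont).trans hYp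
  have hJp : (fun p : ℝ × ℝ => J p.1 - J t₀) =O[𝓝 (t₀, θ₀)] fun p => p - (t₀, θ₀) :=
    (hJ.hasFDerivAt.isBigO_sub.comp_tendsto htend).trans hfst
  obtain ⟨K₁, hK₁, hFb⟩ := hFp.exists_nonneg
  obtain ⟨K₂, hK₂, hJb⟩ := hJp.exists_nonneg
  obtain ⟨s, hs, hall⟩ := Metric.eventually_nhds_iff.1 (hdom.and (hFb.bound.and hJb.bound))
  refine IsBigO.of_bound (K₁ + 2 * |C| + K₂) ?_
  filter_upwards [Metric.ball_mem_nhds _ hs] with q hq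
  obtain ⟨⟨t', θ'⟩, ⟨t, θ⟩⟩ := q
  rw [Metric.mem_ball, dist_eq_norm] at hq
  set n := ‖(((t', θ'), (t, θ)) : (ℝ × ℝ) × (ℝ × ℝ)) - ((t₀, θ₀), (t₀, θ₀))‖ with hn
  set m := ‖((t', θ') : ℝ × ℝ) - (t, θ)‖ with hm
  have hn0 : 0 ≤ n := norm_nonneg _
  have hm0 : 0 ≤ m := norm_nonneg _
  have hn' : n = max (max |t' - t₀| |θ' - θ₀|) (max |t - t₀| |θ - θ₀|) := rfl
  have hm' : m = max |t' - t| |θ' - θ| := rfl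
  have b1 : |t' - t₀| ≤ n := by rw [hn']; simp
  have b2 : |θ' - θ₀| ≤ n := by rw [hn']; simp
  have b3 : |t - t₀| ≤ n := by rw [hn']; simp
  have b4 : |θ - θ₀| ≤ n := by rw [hn']; simp
  have b5 : |t' - t| ≤ m := by rw [hm']; simp
  have b6 : |θ' - θ| ≤ m := by rw [hm']; simp
  have hball : ∀ τ ∈ Metric.closedBall t₀ n, dist ((τ, θ') : ℝ × ℝ) (t₀, θ₀) ≤ n := by
    intro τ hτ
    exact max_le hτ b2
  have h1 : ‖Y t' θ' - Y t θ' - (t' - t) • F (Y t₀ θ₀)‖ ≤ K₁ * n * m := by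
    have h := (convex_closedBall t₀ n).norm_image_sub_le_of_norm_hasDerivWithin_le
      (f := fun τ => Y τ θ' - τ • F (Y t₀ θ₀)) (f' := fun τ => F (Y τ θ') - (1 : ℝ) • F (Y t₀ θ₀))
      (C := K₁ * n) (x := t) (y := t')
      (fun τ hτ => by
        have hτ' := hall ((hball τ hτ).trans_lt hq)
        refine HasDerivWithinAt.sub ?_ ((hasDerivWithinAt_id τ _).smul_const _)
        refine (hY θ' hτ'.1.2 τ hτ'.1.1).mono fun τ₂ hτ₂ => ?_
        exact (hall ((hball τ₂ hτ₂).trans_lt hq)).1.1)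
      (fun τ hτ => by
        have hτ' := hall ((hball τ hτ).trans_lt hq)
        rw [one_smul]
        refine hτ'.2.1.trans ?_
        gcongr
        rw [← dist_eq_norm]
        exact hball τ hτ)
      b3 b1
    calc _ = ‖Y t' θ' - t' • F (Y t₀ θ₀) - (Y t θ' - t • F (Y t₀ θ₀))‖ := by
          congr 1
          rw [sub_smul]
          abel
      _ ≤ K₁ * n * |t' - t| := h
      _ ≤ _ := by gcongr
  have hp : dist ((t, θ) : ℝ × ℝ) (t₀, θ₀) < s :=
    lt_of_le_of_lt (max_le b3 b4) hq
  have hp' : dist ((t', θ') : ℝ × ℝ) (t₀, θ₀) < s :=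
    lt_of_le_of_lt (max_le b1 b2) hq
  have h2 : ‖Y t θ' - Y t θ - (θ' - θ) • J t‖ ≤ 2 * |C| * n * m := by
    refine ((hC θ (hall hp).1.2 θ' (hall hp').1.2 t (hall hp).1.1).2).trans ?_
    calc C * (|θ - θ₀| + |θ' - θ₀|) * |θ' - θ| ≤ |C| * (n + n) * m := by
          gcongr
          exact le_abs_self C
      _ = _ := by ring
  have h3 : ‖(θ' - θ) • (J t - J t₀)‖ ≤ K₂ * n * m := by
    rw [norm_smul, Real.norm_eq_abs]
    have := (hall hp).2.2
    have h4 : ‖((t, θ) : ℝ × ℝ) - (t₀, θ₀)‖ ≤ n := max_le b3 b4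
    calc |θ' - θ| * ‖J t - J t₀‖ ≤ m * (K₂ * n) := by
          gcongr
          exact this.trans (by gcongr)
      _ = _ := by ring
  rw [norm_mul, Real.norm_of_nonneg hn0, Real.norm_of_nonneg hm0]
  calc _ = ‖(Y t' θ' - Y t θ' - (t' - t) • F (Y t₀ θ₀))
        + (Y t θ' - Y t θ - (θ' - θ) • J t) + (θ' - θ) • (J t - J t₀)‖ := by
        congr 1
        simp only [Prod.mk_sub_mk, smul_sub]
        abel
    _ ≤ K₁ * n * m + 2 * |C| * n * m + K₂ * n * m :=
        (norm_add_le _ _).trans (add_le_add ((norm_add_le _ _).trans (add_le_add h1 h2)) h3)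
    _ = _ := by ring

end Flow

/-! ### Geodesics as integral curves on phase space -/

/-- The geodesic vector field of the Fermat metric on phase space, where a point `(x, e)` consists
of a position `x = (r, z)` and of the velocity divided by the sound speed, `e = ẋ / c(z)`. For a
curve parameterized by travel time, `e` is the Euclidean unit tangent. -/
noncomputable def phaseField (c : ℝ → ℝ) (y : (ℝ × ℝ) × (ℝ × ℝ)) : (ℝ × ℝ) × (ℝ × ℝ) :=
  ((c y.1.2 * y.2.1, c y.1.2 * y.2.2),
    (deriv c y.1.2 * (y.2.1 * y.2.2), -(deriv c y.1.2 * y.2.1 ^ 2)))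

/-- The point of phase space given by a position and a velocity. -/
noncomputable def toPhase (c : ℝ → ℝ) (x v : ℝ × ℝ) : (ℝ × ℝ) × (ℝ × ℝ) :=
  (x, ((c x.2)⁻¹ * v.1, (c x.2)⁻¹ * v.2))

lemma hasDerivWithinAt_prodMk_iff {E₁ E₂ : Type*} [NormedAddCommGroup E₁] [NormedSpace ℝ E₁]
    [NormedAddCommGroup E₂] [NormedSpace ℝ E₂] {f : ℝ → E₁ × E₂} {f' : E₁ × E₂} {I : Set ℝ}
    {t : ℝ} : HasDerivWithinAt f f' I t ↔
      HasDerivWithinAt (fun s => (f s).1) f'.1 I t ∧ HasDerivWithinAt (fun s => (f s).2) f'.2 I t :=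
  ⟨fun h => ⟨(ContinuousLinearMap.fst ℝ E₁ E₂).hasFDerivAt.comp_hasDerivWithinAt t h,
      (ContinuousLinearMap.snd ℝ E₁ E₂).hasFDerivAt.comp_hasDerivWithinAt t h⟩,
    fun h => h.1.prodMk h.2⟩

variable {c : ℝ → ℝ} {D : Set ℝ}

lemma hasDerivAt_of_mem (hD : IsOpen D) (hc : ContDiffOn ℝ 3 c D) {z : ℝ} (hz : z ∈ D) :
    HasDerivAt c (deriv c z) z :=
  ((hc.differentiableOn (by norm_num)).differentiableAt (hD.mem_nhds hz)).hasDerivAt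

lemma contDiffOn_deriv (hD : IsOpen D) (hc : ContDiffOn ℝ 3 c D) :
    ContDiffOn ℝ 2 (deriv c) D :=
  hc.deriv_of_isOpen hD (by norm_num)

lemma hasDerivAt_deriv_of_mem (hD : IsOpen D) (hc : ContDiffOn ℝ 3 c D) {z : ℝ} (hz : z ∈ D) :
    HasDerivAt (deriv c) (deriv (deriv c) z) z :=
  (((contDiffOn_deriv hD hc).differentiableOn (by norm_num)).differentiableAt
    (hD.mem_nhds hz)).hasDerivAt

lemma isOpen_phaseDomain (hD : IsOpen D) : IsOpen {y : (ℝ × ℝ) × (ℝ × ℝ) | y.1.2 ∈ D} :=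
  hD.preimage (by fun_prop)

lemma contDiffOn_phaseField (hD : IsOpen D) (hc : ContDiffOn ℝ 3 c D) :
    ContDiffOn ℝ 2 (phaseField c) {y | y.1.2 ∈ D} := by
  have h0 : ContDiffOn ℝ 2 (fun y : (ℝ × ℝ) × (ℝ × ℝ) => c y.1.2) {y | y.1.2 ∈ D} :=
    (hc.of_le (by norm_num)).comp (by fun_prop) fun y hy => hy
  have h1 : ContDiffOn ℝ 2 (fun y : (ℝ × ℝ) × (ℝ × ℝ) => deriv c y.1.2) {y | y.1.2 ∈ D} :=
    (contDiffOn_deriv hD hc).comp (by fun_prop) fun y hy => hy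
  have h2 : ContDiffOn ℝ 2 (fun y : (ℝ × ℝ) × (ℝ × ℝ) => y.2.1) {y | y.1.2 ∈ D} := by fun_prop
  have h3 : ContDiffOn ℝ 2 (fun y : (ℝ × ℝ) × (ℝ × ℝ) => y.2.2) {y | y.1.2 ∈ D} := by fun_prop
  exact ((h0.mul h2).prodMk (h0.mul h3)).prodMk
    ((h1.mul (h2.mul h3)).prodMk (h1.mul (h2.pow 2)).neg)

lemma fderiv_phaseField_apply (hD : IsOpen D) (hc : ContDiffOn ℝ 3 c D)
    {y : (ℝ × ℝ) × (ℝ × ℝ)} (hy : y.1.2 ∈ D) (v : (ℝ × ℝ) × (ℝ × ℝ)) :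
    fderiv ℝ (phaseField c) y v =
      ((deriv c y.1.2 * v.1.2 * y.2.1 + c y.1.2 * v.2.1,
        deriv c y.1.2 * v.1.2 * y.2.2 + c y.1.2 * v.2.2),
       (deriv (deriv c) y.1.2 * v.1.2 * (y.2.1 * y.2.2)
          + deriv c y.1.2 * (v.2.1 * y.2.2 + y.2.1 * v.2.2),
        -(deriv (deriv c) y.1.2 * v.1.2 * y.2.1 ^ 2
          + deriv c y.1.2 * (2 * y.2.1 * v.2.1)))) := by
  have hd : DifferentiableAt ℝ (phaseField c) y :=
    ((contDiffOn_phaseField hD hc).differentiableOn (by norm_num)).differentiableAt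
      ((isOpen_phaseDomain hD).mem_nhds hy)
  -- both sides are the derivative of the field along the line through `y` with direction `v`
  have hl : ∀ α β : ℝ, HasDerivAt (fun s : ℝ => α + s * β) β 0 := fun α β => by
    simpa using ((hasDerivAt_id (0 : ℝ)).mul_const β).const_add α
  have h1 : HasDerivAt (fun s : ℝ => phaseField c (y + s • v)) (fderiv ℝ (phaseField c) y v) 0 := by
    have hl' : HasDerivAt (fun s : ℝ => y + s • v) v 0 := by
      simpa using ((hasDerivAt_id (0 : ℝ)).smul_const v).const_add y
    have hd' : HasFDerivAt (phaseField c) (fderiv ℝ (phaseField c) y) (y + (0 : ℝ) • v) := by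
      simpa using hd.hasFDerivAt
    exact hd'.comp_hasDerivAt (0 : ℝ) hl'
  have hz := hl y.1.2 v.1.2
  have hc0 : HasDerivAt (fun s : ℝ => c (y.1.2 + s * v.1.2)) (deriv c y.1.2 * v.1.2) 0 :=
    HasDerivAt.comp (h₂ := c) (0 : ℝ)
      (by rw [zero_mul, add_zero]; exact hasDerivAt_of_mem hD hc hy) hz
  have hc1 : HasDerivAt (fun s : ℝ => deriv c (y.1.2 + s * v.1.2))
      (deriv (deriv c) y.1.2 * v.1.2) 0 :=
    HasDerivAt.comp (h₂ := deriv c) (0 : ℝ)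
      (by rw [zero_mul, add_zero]; exact hasDerivAt_deriv_of_mem hD hc hy) hz
  have h2 := ((hc0.mul (hl y.2.1 v.2.1)).prodMk (hc0.mul (hl y.2.2 v.2.2))).prodMk
    ((hc1.mul ((hl y.2.1 v.2.1).mul (hl y.2.2 v.2.2))).prodMk
      (hc1.mul ((hl y.2.1 v.2.1).pow 2)).neg)
  refine h1.unique (h2.congr_deriv ?_)
  simp

/-- Divided by the sound speed, the velocity of a geodesic follows the geodesic vector field. -/
lemma IsFermatGeodesic.hasDerivWithinAt_toPhase (hD : IsOpen D) (hc : ContDiffOn ℝ 3 c D)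
    (hpos : ∀ z ∈ D, 0 < c z) {I : Set ℝ} {x v : ℝ → ℝ × ℝ} (h : IsFermatGeodesic c D I x v)
    {t : ℝ} (ht : t ∈ I) :
    HasDerivWithinAt (fun s => toPhase c (x s) (v s))
      (phaseField c (toPhase c (x t) (v t))) I t := by
  have hz := h.mem t ht
  have hne : c (x t).2 ≠ 0 := (hpos _ hz).ne'
  have hx := h.velocity t ht
  obtain ⟨hv1, hv2⟩ := hasDerivWithinAt_prodMk_iff.1 (h.acceleration t ht)
  have hinv : HasDerivWithinAt (fun s => (c (x s).2)⁻¹)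
      (-(deriv c (x t).2 * (v t).2) / c (x t).2 ^ 2) I t :=
    ((hasDerivAt_of_mem hD hc hz).comp_hasDerivWithinAt t
      (hasDerivWithinAt_prodMk_iff.1 hx).2).inv hne
  refine hasDerivWithinAt_prodMk_iff.2 ⟨hx.congr_deriv ?_, hasDerivWithinAt_prodMk_iff.2
    ⟨(hinv.mul hv1).congr_deriv ?_, (hinv.mul hv2).congr_deriv ?_⟩⟩
  · ext <;> simp [phaseField, toPhase, hne]
  · simp only [phaseField, toPhase, rayAcceleration]
    field_simp
    ring
  · simp only [phaseField, toPhase, rayAcceleration]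
    field_simp
    ring

/-- The Jacobi field along the curve `y` in phase space whose component normal to the curve, in a
parallel frame, is `a`. The summand `c' e₂ a` of the second half is the turning of the unit tangent
that comes from measuring angles in the conformally flat coordinates. -/
noncomputable def jacobiField (c : ℝ → ℝ) (y : ℝ → (ℝ × ℝ) × (ℝ × ℝ)) (a a' : ℝ → ℝ) (t : ℝ) :
    (ℝ × ℝ) × (ℝ × ℝ) :=
  ((a t * c (y t).1.2 * (y t).2.2, -(a t * c (y t).1.2 * (y t).2.1)),
    ((a' t + a t * deriv c (y t).1.2 * (y t).2.2) * (y t).2.2,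
      -((a' t + a t * deriv c (y t).1.2 * (y t).2.2) * (y t).2.1)))

/-- Jacobi's equation is the linearization of the geodesic equation in the normal direction. -/
lemma hasDerivWithinAt_jacobiField (hD : IsOpen D) (hc : ContDiffOn ℝ 3 c D)
    {I : Set ℝ} {y : ℝ → (ℝ × ℝ) × (ℝ × ℝ)} {a a' : ℝ → ℝ} {t : ℝ}
    (hy : HasDerivWithinAt y (phaseField c (y t)) I t) (hyD : (y t).1.2 ∈ D)
    (hunit : (y t).2.1 ^ 2 + (y t).2.2 ^ 2 = 1)
    (ha : HasDerivWithinAt a (a' t) I t)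
    (ha' : HasDerivWithinAt a' (-(gaussCurvature c (y t).1.2 * a t)) I t) :
    HasDerivWithinAt (jacobiField c y a a')
      (fderiv ℝ (phaseField c) (y t) (jacobiField c y a a' t)) I t := by
  obtain ⟨h1, h2⟩ := hasDerivWithinAt_prodMk_iff.1 hy
  obtain ⟨he1, he2⟩ := hasDerivWithinAt_prodMk_iff.1 h2
  have hz := (hasDerivWithinAt_prodMk_iff.1 h1).2
  have hc0 := (hasDerivAt_of_mem hD hc hyD).comp_hasDerivWithinAt t hz
  have hc1 := (hasDerivAt_deriv_of_mem hD hc hyD).comp_hasDerivWithinAt t hz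
  have hb := ha'.add ((ha.mul hc1).mul he2)
  have hac := ha.mul hc0
  have H := ((hac.mul he2).prodMk (hac.mul he1).neg).prodMk ((hb.mul he2).prodMk (hb.mul he1).neg)
  refine H.congr_deriv ?_
  rw [fderiv_phaseField_apply hD hc hyD]
  simp only [jacobiField, phaseField, gaussCurvature, Function.comp_apply, Pi.mul_apply,
    Pi.add_apply]
  generalize (y t).2.1 = e₁ at *
  generalize (y t).2.2 = e₂ at *
  generalize c (y t).1.2 = c₀
  generalize deriv c (y t).1.2 = c₁
  generalize deriv (deriv c) (y t).1.2 = c₂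
  have hs : e₁ ^ 2 = 1 - e₂ ^ 2 := by linarith
  ext
  · simp only
    ring
  · simp only
    ring
  · simp only
    linear_combination (a t * e₂ * (c₀ * c₂ - c₁ ^ 2)) * hs
  · simp only
    linear_combination (a t * e₁ * (c₁ ^ 2 - c₀ * c₂)) * hs

/-- The Euclidean length of `e = ẋ / c` is constant along geodesics. -/
lemma sq_add_sq_eq_of_solution {b : ℝ} {y : ℝ → (ℝ × ℝ) × (ℝ × ℝ)}
    (hy : ∀ t ∈ Icc 0 b, HasDerivWithinAt y (phaseField c (y t)) (Icc 0 b) t) :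
    ∀ t ∈ Icc 0 b, (y t).2.1 ^ 2 + (y t).2.2 ^ 2 = (y 0).2.1 ^ 2 + (y 0).2.2 ^ 2 := by
  have hd : ∀ t ∈ Icc 0 b, HasDerivWithinAt (fun t => (y t).2.1 ^ 2 + (y t).2.2 ^ 2) 0
      (Icc 0 b) t := by
    intro t ht
    obtain ⟨he1, he2⟩ := hasDerivWithinAt_prodMk_iff.1 (hasDerivWithinAt_prodMk_iff.1 (hy t ht)).2
    refine ((he1.pow 2).add (he2.pow 2)).congr_deriv ?_
    simp only [phaseField]
    push_cast
    ring
  exact constant_of_has_deriv_right_zero (fun t ht => (hd t ht).continuousWithinAt)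
    fun t ht => (hd t (Ico_subset_Icc_self ht)).mono_of_mem_nhdsWithin (Icc_mem_nhdsGE_of_mem ht)

/-! ### The Gauss lemma and the eikonal estimate -/

/-- The slowness covector `e / c` of a point `y = (x, e)` of phase space, applied to a vector `u`:
the Fermat inner product of the velocity `c e` with `u`. -/
noncomputable def slowness (c : ℝ → ℝ) (y : (ℝ × ℝ) × (ℝ × ℝ)) (u : ℝ × ℝ) : ℝ :=
  (c y.1.2)⁻¹ * (y.2.1 * u.1 + y.2.2 * u.2)

/-- Hamilton's equation for the slowness: its horizontal component is conserved, which is Snell's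
law, and the vertical one changes at the rate `-c'/c`. -/
lemma hasDerivWithinAt_slowness (hD : IsOpen D) (hc : ContDiffOn ℝ 3 c D)
    (hpos : ∀ z ∈ D, 0 < c z) {I : Set ℝ} {y : ℝ → (ℝ × ℝ) × (ℝ × ℝ)} {u : ℝ → ℝ × ℝ} {u' : ℝ × ℝ}
    {t : ℝ} (hy : HasDerivWithinAt y (phaseField c (y t)) I t) (hyD : (y t).1.2 ∈ D)
    (hunit : (y t).2.1 ^ 2 + (y t).2.2 ^ 2 = 1) (hu : HasDerivWithinAt u u' I t) :
    HasDerivWithinAt (fun s => slowness c (y s) (u s))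
      (slowness c (y t) u' - (c (y t).1.2)⁻¹ * deriv c (y t).1.2 * (u t).2) I t := by
  obtain ⟨h1, h2⟩ := hasDerivWithinAt_prodMk_iff.1 hy
  obtain ⟨he1, he2⟩ := hasDerivWithinAt_prodMk_iff.1 h2
  obtain ⟨hu1, hu2⟩ := hasDerivWithinAt_prodMk_iff.1 hu
  have hne : c (y t).1.2 ≠ 0 := (hpos _ hyD).ne'
  have hinv := ((hasDerivAt_of_mem hD hc hyD).comp_hasDerivWithinAt t
    (hasDerivWithinAt_prodMk_iff.1 h1).2).inv hne
  refine (hinv.mul ((he1.mul hu1).add (he2.mul hu2))).congr_deriv ?_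
  simp only [phaseField, slowness, Function.comp_apply, Pi.mul_apply, Pi.add_apply, Pi.inv_apply]
  field_simp
  linear_combination (-(deriv c (y t).1.2) * (u t).2) * hunit

/-- The rate of change of the slowness applied to the chord between two solutions is of second
order in their distance. -/
lemma abs_slowness_defect_le {M : ℝ} {y y' : (ℝ × ℝ) × (ℝ × ℝ)} (hc0 : c y.1.2 ≠ 0)
    (hunit : y.2.1 ^ 2 + y.2.2 ^ 2 = 1) (hunit' : y'.2.1 ^ 2 + y'.2.2 ^ 2 = 1)
    (hinv : |(c y.1.2)⁻¹| ≤ M) (hbd : |c y'.1.2| ≤ M)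
    (htaylor : |c y'.1.2 - c y.1.2 - deriv c y.1.2 * (y'.1.2 - y.1.2)| ≤ M * |y'.1.2 - y.1.2| ^ 2) :
    |slowness c y ((phaseField c y').1 - (phaseField c y).1)
      - (c y.1.2)⁻¹ * deriv c y.1.2 * (y'.1.2 - y.1.2)| ≤ 2 * M ^ 2 * ‖y' - y‖ ^ 2 := by
  have hM : 0 ≤ M := (abs_nonneg _).trans hinv
  have hz : |y'.1.2 - y.1.2| ≤ ‖y' - y‖ := (norm_snd_le _).trans (norm_fst_le (y' - y))
  have h1 : |y'.2.1 - y.2.1| ≤ ‖y' - y‖ := (norm_fst_le _).trans (norm_snd_le (y' - y))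
  have h2 : |y'.2.2 - y.2.2| ≤ ‖y' - y‖ := (norm_snd_le _).trans (norm_snd_le (y' - y))
  have key : slowness c y ((phaseField c y').1 - (phaseField c y).1)
      - (c y.1.2)⁻¹ * deriv c y.1.2 * (y'.1.2 - y.1.2)
      = (c y.1.2)⁻¹ * (c y'.1.2 - c y.1.2 - deriv c y.1.2 * (y'.1.2 - y.1.2))
        - (c y.1.2)⁻¹ * (c y'.1.2 * (((y'.2.1 - y.2.1) ^ 2 + (y'.2.2 - y.2.2) ^ 2) / 2)) := by
    simp only [slowness, phaseField, Prod.fst_sub, Prod.snd_sub]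
    field_simp
    linear_combination (c y'.1.2 - 2 * c y.1.2) * hunit + c y'.1.2 * hunit'
  have h3 : |((y'.2.1 - y.2.1) ^ 2 + (y'.2.2 - y.2.2) ^ 2) / 2| ≤ ‖y' - y‖ ^ 2 := by
    rw [abs_of_nonneg (by positivity)]
    nlinarith [sq_le_sq' (abs_le.1 h1).1 (abs_le.1 h1).2, sq_le_sq' (abs_le.1 h2).1 (abs_le.1 h2).2]
  rw [key]
  refine (abs_sub _ _).trans ?_
  rw [abs_mul, abs_mul _ (c y'.1.2 * _), abs_mul (c y'.1.2)]
  calc _ ≤ M * (M * ‖y' - y‖ ^ 2) + M * (M * ‖y' - y‖ ^ 2) := by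
        gcongr
        exact htaylor.trans (by gcongr)
    _ = _ := by ring

/-- The slowness of `y`, applied to the velocity at `y'`, differs from its value `1` at `y' = y` by
at most a multiple of the distance. -/
lemma abs_slowness_phaseField_sub_one_le {M : ℝ} {y y' : (ℝ × ℝ) × (ℝ × ℝ)} (hc0 : c y.1.2 ≠ 0)
    (hunit : y.2.1 ^ 2 + y.2.2 ^ 2 = 1)
    (hinv : |(c y.1.2)⁻¹| ≤ M) (hbd : |c y'.1.2| ≤ M)
    (hlip : |c y'.1.2 - c y.1.2| ≤ M * |y'.1.2 - y.1.2|) :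
    |slowness c y (phaseField c y').1 - 1| ≤ 3 * M ^ 2 * ‖y' - y‖ := by
  have hM : 0 ≤ M := (abs_nonneg _).trans hinv
  have hz : |y'.1.2 - y.1.2| ≤ ‖y' - y‖ := (norm_snd_le _).trans (norm_fst_le (y' - y))
  have h1 : |y'.2.1 - y.2.1| ≤ ‖y' - y‖ := (norm_fst_le _).trans (norm_snd_le (y' - y))
  have h2 : |y'.2.2 - y.2.2| ≤ ‖y' - y‖ := (norm_snd_le _).trans (norm_snd_le (y' - y))
  have key : slowness c y (phaseField c y').1 - 1
      = (c y.1.2)⁻¹ * (c y'.1.2 - c y.1.2)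
        + (c y.1.2)⁻¹ * (c y'.1.2 * (y.2.1 * (y'.2.1 - y.2.1) + y.2.2 * (y'.2.2 - y.2.2))) := by
    simp only [slowness, phaseField]
    field_simp
    linear_combination (c y'.1.2) * hunit
  have he1 : |y.2.1| ≤ 1 := abs_le_one_iff_mul_self_le_one.2 (by nlinarith [sq_nonneg y.2.2])
  have he2 : |y.2.2| ≤ 1 := abs_le_one_iff_mul_self_le_one.2 (by nlinarith [sq_nonneg y.2.1])
  have h3 : |y.2.1 * (y'.2.1 - y.2.1) + y.2.2 * (y'.2.2 - y.2.2)| ≤ 2 * ‖y' - y‖ := by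
    refine (abs_add_le _ _).trans ?_
    rw [abs_mul, abs_mul]
    calc _ ≤ 1 * ‖y' - y‖ + 1 * ‖y' - y‖ := by gcongr
      _ = _ := by ring
  rw [key]
  refine (abs_add_le _ _).trans ?_
  rw [abs_mul, abs_mul _ (c y'.1.2 * _), abs_mul (c y'.1.2)]
  calc _ ≤ M * (M * ‖y' - y‖) + M * (M * (2 * ‖y' - y‖)) := by
        gcongr
        exact hlip.trans (by gcongr)
    _ = _ := by ring

/-- The eikonal equation `∇T = e / c` of the travel time of a family of rays from a common point,
in finite-difference form: up to second order, the difference of travel times is the slowness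
applied to the difference of positions. The case of equal times is the Gauss lemma. -/
lemma isBigO_slowness_sub_sub (hD : IsOpen D) (hc : ContDiffOn ℝ 3 c D)
    (hpos : ∀ z ∈ D, 0 < c z) {Y : ℝ → ℝ → (ℝ × ℝ) × (ℝ × ℝ)} {b t₀ θ₀ C r : ℝ}
    (ht₀ : t₀ ∈ Ioo 0 b) (hr : 0 < r) (hC0 : 0 ≤ C)
    (hY : ∀ θ ∈ Metric.ball θ₀ r, ∀ t ∈ Icc 0 b,
      HasDerivWithinAt (fun t => Y t θ) (phaseField c (Y t θ)) (Icc 0 b) t)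
    (hYD : ∀ θ ∈ Metric.ball θ₀ r, ∀ t ∈ Icc 0 b, (Y t θ).1.2 ∈ D)
    (hunit : ∀ θ ∈ Metric.ball θ₀ r, ∀ t ∈ Icc 0 b, (Y t θ).2.1 ^ 2 + (Y t θ).2.2 ^ 2 = 1)
    (hsource : ∀ θ ∈ Metric.ball θ₀ r, (Y 0 θ).1 = (Y 0 θ₀).1)
    (hC : ∀ θ ∈ Metric.ball θ₀ r, ∀ θ' ∈ Metric.ball θ₀ r, ∀ t ∈ Icc 0 b,
        ‖Y t θ' - Y t θ‖ ≤ C * |θ' - θ|)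
    (hYlip : (fun q : (ℝ × ℝ) × (ℝ × ℝ) => Y q.1.1 q.1.2 - Y q.2.1 q.2.2)
      =O[𝓝 ((t₀, θ₀), (t₀, θ₀))] fun q => q.1 - q.2) :
    (fun q : (ℝ × ℝ) × (ℝ × ℝ) =>
        slowness c (Y q.2.1 q.2.2) ((Y q.1.1 q.1.2).1 - (Y q.2.1 q.2.2).1) - (q.1.1 - q.2.1))
      =O[𝓝 ((t₀, θ₀), (t₀, θ₀))] fun q => ‖q.1 - q.2‖ ^ 2 := by
  have hθ₀ : θ₀ ∈ Metric.ball θ₀ r := Metric.mem_ball_self hr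
  have hI : Icc 0 b ∈ 𝓝 t₀ := Icc_mem_nhds ht₀.1 ht₀.2
  have ht₀I : t₀ ∈ Icc 0 b := Ioo_subset_Icc_self ht₀
  have hz₀ : ContinuousOn (fun t => (Y t θ₀).1.2) (Icc 0 b) := fun t ht =>
    (hY θ₀ hθ₀ t ht).continuousWithinAt.fst.snd
  have hcpt := isCompact_Icc.image_of_continuousOn hz₀
  have hsubD := image_subset_iff.2 (hYD θ₀ hθ₀)
  obtain ⟨ρ₁, hρ₁, M₁, hM₁, hb₁⟩ := exists_uniform_taylor_bound hcpt hD hsubD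
    (hc.of_le (by norm_num))
  obtain ⟨ρ₂, hρ₂, M₂, hM₂, hb₂⟩ := exists_uniform_bounds hcpt hD hsubD
    (f := fun z => (c z)⁻¹) ((hc.of_le (by norm_num)).inv fun z hz => (hpos z hz).ne')
  set ρ := min ρ₁ ρ₂
  have hρ : 0 < ρ := lt_min hρ₁ hρ₂
  set M := max M₁ M₂
  have hM : 0 ≤ M := by
    have : M₁ ≤ M := le_max_left _ _
    linarith
  have hbd : ∀ t ∈ Icc 0 b, ∀ z ∈ Metric.closedBall (Y t θ₀).1.2 ρ,
      |(c z)⁻¹| ≤ M ∧ |c z| ≤ M ∧ ∀ z' ∈ Metric.closedBall (Y t θ₀).1.2 ρ,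
        |c z' - c z| ≤ M * |z' - z| ∧
          |c z' - c z - deriv c z * (z' - z)| ≤ M * |z' - z| ^ 2 := by
    intro t ht z hz
    have hz1 := Metric.closedBall_subset_closedBall (min_le_left ρ₁ ρ₂) hz
    have hz2 := Metric.closedBall_subset_closedBall (min_le_right ρ₁ ρ₂) hz
    refine ⟨(hb₂ _ (mem_image_of_mem _ ht) z hz2).2.1.trans (le_max_right _ _),
      (hb₁ _ (mem_image_of_mem _ ht) z hz1).1.trans (le_max_left _ _), fun z' hz' => ?_⟩
    have hz1' := Metric.closedBall_subset_closedBall (min_le_left ρ₁ ρ₂) hz'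
    have h := (hb₁ _ (mem_image_of_mem _ ht) z hz1).2 z' hz1'
    simp only [fderiv_eq_smul_deriv, smul_eq_mul, Real.norm_eq_abs] at h
    rw [mul_comm (deriv c z)]
    refine ⟨h.1.trans ?_, h.2.trans ?_⟩ <;> gcongr <;> exact le_max_left _ _
  set r' := min r (ρ / (C + 1)) with hr'
  have hr'0 : 0 < r' := by positivity
  have hr'r : Metric.ball θ₀ r' ⊆ Metric.ball θ₀ r := Metric.ball_subset_ball (min_le_left _ _)
  have htube : ∀ θ ∈ Metric.ball θ₀ r', ∀ t ∈ Icc 0 b,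
      (Y t θ).1.2 ∈ Metric.closedBall (Y t θ₀).1.2 ρ := by
    intro θ hθ t ht
    have h1 := hC θ₀ hθ₀ θ (hr'r hθ) t ht
    have h2 : |θ - θ₀| < ρ / (C + 1) := by
      rw [Metric.mem_ball, Real.dist_eq] at hθ
      exact hθ.trans_le (min_le_right _ _)
    rw [lt_div_iff₀ (by positivity)] at h2
    rw [mem_closedBall_iff_norm]
    have h3 : ‖(Y t θ).1.2 - (Y t θ₀).1.2‖ ≤ ‖Y t θ - Y t θ₀‖ :=
      (norm_snd_le _).trans (norm_fst_le (Y t θ - Y t θ₀))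
    nlinarith [abs_nonneg (θ - θ₀)]
  -- the Gauss lemma: at equal times the slowness annihilates the chord to second order
  have hgauss : ∀ θ ∈ Metric.ball θ₀ r', ∀ θ' ∈ Metric.ball θ₀ r', ∀ t ∈ Icc 0 b,
      |slowness c (Y t θ) ((Y t θ').1 - (Y t θ).1)| ≤ 2 * M ^ 2 * C ^ 2 * b * |θ' - θ| ^ 2 := by
    intro θ hθ θ' hθ' t ht
    have h0b : (0 : ℝ) ∈ Icc 0 b := ⟨le_rfl, ht.1.trans ht.2⟩
    have h := (convex_Icc 0 b).norm_image_sub_le_of_norm_hasDerivWithin_le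
      (f := fun s => slowness c (Y s θ) ((Y s θ').1 - (Y s θ).1))
      (C := 2 * M ^ 2 * (C * |θ' - θ|) ^ 2)
      (fun s hs => hasDerivWithinAt_slowness hD hc hpos (hY θ (hr'r hθ) s hs)
        (hYD θ (hr'r hθ) s hs) (hunit θ (hr'r hθ) s hs)
        ((hasDerivWithinAt_prodMk_iff.1 (hY θ' (hr'r hθ') s hs)).1.sub
          (hasDerivWithinAt_prodMk_iff.1 (hY θ (hr'r hθ) s hs)).1))
      (fun s hs => by
        have hzs := hbd s hs _ (htube θ hθ s hs)
        refine (abs_slowness_defect_le (hpos _ (hYD θ (hr'r hθ) s hs)).ne'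
          (hunit θ (hr'r hθ) s hs) (hunit θ' (hr'r hθ') s hs) hzs.1
          (hbd s hs _ (htube θ' hθ' s hs)).2.1 (hzs.2.2 _ (htube θ' hθ' s hs)).2).trans ?_
        gcongr
        exact hC θ (hr'r hθ) θ' (hr'r hθ') s hs) h0b ht
    rw [hsource θ (hr'r hθ), hsource θ' (hr'r hθ')] at h
    have h0 : slowness c (Y 0 θ) ((Y 0 θ₀).1 - (Y 0 θ₀).1) = 0 := by simp [slowness]
    rw [h0, sub_zero, sub_zero, Real.norm_eq_abs, Real.norm_eq_abs, abs_of_nonneg ht.1] at h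
    refine h.trans ?_
    calc _ ≤ 2 * M ^ 2 * (C * |θ' - θ|) ^ 2 * b := by
          gcongr
          exact ht.2
      _ = _ := by ring
  obtain ⟨K, hK, hKb⟩ := hYlip.exists_nonneg
  have hcont : Tendsto (fun p : ℝ × ℝ => (Y p.1 p.2).1.2) (𝓝 (t₀, θ₀)) (𝓝 (Y t₀ θ₀).1.2) := by
    have h1 : Tendsto (fun p : ℝ × ℝ => (p, (t₀, θ₀))) (𝓝 (t₀, θ₀)) (𝓝 ((t₀, θ₀), (t₀, θ₀))) :=
      (Continuous.prodMk_left _).tendsto _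
    have h2 : Tendsto (fun p : ℝ × ℝ => Y p.1 p.2 - Y t₀ θ₀) (𝓝 (t₀, θ₀)) (𝓝 0) := by
      refine (hYlip.comp_tendsto h1).trans_tendsto ?_
      simp only [Function.comp_def]
      rw [tendsto_sub_nhds_zero_iff]
      exact tendsto_id
    exact (tendsto_sub_nhds_zero_iff.1 h2).fst_nhds.snd_nhds
  have hev : ∀ᶠ p : ℝ × ℝ in 𝓝 (t₀, θ₀), p.1 ∈ Icc 0 b ∧ p.2 ∈ Metric.ball θ₀ r' ∧
      (Y p.1 p.2).1.2 ∈ Metric.closedBall (Y t₀ θ₀).1.2 ρ :=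
    (continuous_fst.continuousAt.eventually_mem hI).and
      ((continuous_snd.continuousAt.eventually_mem (Metric.ball_mem_nhds _ hr'0)).and
        (hcont.eventually_mem (Metric.closedBall_mem_nhds _ hρ)))
  obtain ⟨s₁, hs₁, hall⟩ := Metric.eventually_nhds_iff_ball.1 hev
  obtain ⟨s₂, hs₂, hKall⟩ := Metric.eventually_nhds_iff_ball.1 hKb.bound
  refine IsBigO.of_bound (2 * M ^ 2 * C ^ 2 * b + 3 * M ^ 2 * K) ?_
  filter_upwards [Metric.ball_mem_nhds _ (lt_min hs₁ hs₂)] with q hq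
  obtain ⟨⟨t', θ'⟩, ⟨t, θ⟩⟩ := q
  have hq1 := Metric.ball_subset_ball (min_le_left s₁ s₂) hq
  have hq2 := Metric.ball_subset_ball (min_le_right s₁ s₂) hq
  rw [← ball_prod_same] at hq1 hq2
  set m := ‖((t', θ') : ℝ × ℝ) - (t, θ)‖ with hm
  have hm0 : 0 ≤ m := norm_nonneg _
  have hm' : m = max |t' - t| |θ' - θ| := rfl
  have b5 : |t' - t| ≤ m := by rw [hm']; simp
  have b6 : |θ' - θ| ≤ m := by rw [hm']; simp
  have hp := hall _ hq1.2
  have hseg : ∀ s ∈ uIcc t t', ((s, θ') : ℝ × ℝ) ∈ Metric.ball (t₀, θ₀) s₁ ∧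
      ((s, θ') : ℝ × ℝ) ∈ Metric.ball (t₀, θ₀) s₂ := by
    intro s hs
    have hconv : ∀ s₃, ((t', θ') : ℝ × ℝ) ∈ Metric.ball (t₀, θ₀) s₃ →
        ((t, θ) : ℝ × ℝ) ∈ Metric.ball (t₀, θ₀) s₃ →
        ((s, θ') : ℝ × ℝ) ∈ Metric.ball (t₀, θ₀) s₃ := by
      intro s₃ h1 h2
      rw [← ball_prod_same] at h1 h2 ⊢
      exact ⟨(convex_ball t₀ s₃).ordConnected.uIcc_subset h2.1 h1.1 hs, h1.2⟩
    exact ⟨hconv _ hq1.1 hq1.2, hconv _ hq2.1 hq2.2⟩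
  have h := (convex_uIcc t t').norm_image_sub_le_of_norm_hasDerivWithin_le
    (f := fun s => slowness c (Y t θ) ((Y s θ').1 - (Y t θ).1) - (s - t))
    (f' := fun s => slowness c (Y t θ) (phaseField c (Y s θ')).1 - 1)
    (C := 3 * M ^ 2 * (K * m))
    (fun s hs => by
      have hs1 := hall _ (hseg s hs).1
      have hYs := (hY θ' (hr'r hs1.2.1) s hs1.1).mono
        (fun s' hs' => (hall _ (hseg s' hs').1).1 : uIcc t t' ⊆ Icc 0 b)
      obtain ⟨hx1, hx2⟩ := hasDerivWithinAt_prodMk_iff.1 (hasDerivWithinAt_prodMk_iff.1 hYs).1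
      exact ((((hx1.sub_const _).const_mul _).add ((hx2.sub_const _).const_mul _)).const_mul _).sub
        ((hasDerivWithinAt_id s _).sub_const t))
    (fun s hs => by
      have hs1 := hall _ (hseg s hs).1
      have hzt := hbd t₀ ht₀I _ hp.2.2
      refine (abs_slowness_phaseField_sub_one_le (hpos _ (hYD θ (hr'r hp.2.1) t hp.1)).ne'
          (hunit θ (hr'r hp.2.1) t hp.1) hzt.1 (hbd t₀ ht₀I _ hs1.2.2).2.1
          (hzt.2.2 _ hs1.2.2).1).trans ?_
      gcongr
      have h1 := hKall ((s, θ'), (t, θ)) (by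
        rw [← ball_prod_same]
        exact ⟨(hseg s hs).2, hq2.2⟩)
      refine h1.trans ?_
      gcongr
      refine max_le ?_ b6
      exact (abs_sub_left_of_mem_uIcc hs).trans b5)
    left_mem_uIcc right_mem_uIcc
  have hg := hgauss θ hp.2.1 θ' (hall _ hq1.1).2.1 t hp.1
  rw [sub_self, sub_zero] at h
  have hb0 : 0 ≤ b := (ht₀.1.trans ht₀.2).le
  rw [norm_pow, Real.norm_of_nonneg hm0]
  set A := slowness c (Y t θ) ((Y t' θ').1 - (Y t θ).1) - (t' - t) with hA
  set B := slowness c (Y t θ) ((Y t θ').1 - (Y t θ).1)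
  calc |A| = |B + (A - B)| := by congr 1; ring
    _ ≤ |B| + |A - B| := abs_add_le _ _
    _ ≤ 2 * M ^ 2 * C ^ 2 * b * m ^ 2 + 3 * M ^ 2 * (K * m) * m := by
        refine add_le_add (hg.trans (by gcongr)) (h.trans ?_)
        gcongr
        exact b5
    _ = _ := by ring

/-! ### Expansions of curves at a point -/

/-- Integration of a bound `f' = O(μⁿ)`. -/
lemma isBigO_sub_of_hasDerivAt {E : Type*} [NormedAddCommGroup E] [NormedSpace ℝ E]
    {f f' : ℝ → E} {n : ℕ} (hf : ∀ᶠ μ in 𝓝 (0 : ℝ), HasDerivAt f (f' μ) μ)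
    (hf' : f' =O[𝓝 0] fun μ : ℝ => μ ^ n) :
    (fun μ => f μ - f 0) =O[𝓝 0] fun μ : ℝ => μ ^ (n + 1) := by
  obtain ⟨C, hC, hb⟩ := hf'.exists_nonneg
  obtain ⟨s, hs, h⟩ := Metric.eventually_nhds_iff.1 (hf.and hb.bound)
  refine IsBigO.of_bound C ?_
  filter_upwards [Metric.ball_mem_nhds 0 hs] with μ hμ
  rw [Metric.mem_ball, dist_zero_right] at hμ
  have := (convex_closedBall (0 : ℝ) ‖μ‖).norm_image_sub_le_of_norm_hasDerivWithin_le
    (C := C * ‖μ‖ ^ n)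
    (fun x hx => (h (by
      rw [mem_closedBall_zero_iff] at hx
      rw [dist_zero_right]; exact hx.trans_lt hμ)).1.hasDerivWithinAt)
    (fun x hx => by
      rw [mem_closedBall_zero_iff] at hx
      refine (h (by rw [dist_zero_right]; exact hx.trans_lt hμ)).2.trans ?_
      rw [norm_pow]
      gcongr)
    (Metric.mem_closedBall_self (norm_nonneg μ)) (by simp : μ ∈ Metric.closedBall 0 ‖μ‖)
  rw [sub_zero] at this
  rw [norm_pow, pow_succ, ← mul_assoc]
  exact this

/-- An integral curve of a differentiable vector field is approximated to second order by its
tangent. -/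
lemma isBigO_sub_sub_of_integralCurve {E : Type*} [NormedAddCommGroup E] [NormedSpace ℝ E]
    {F : E → E} {y : ℝ → E} (hF : DifferentiableAt ℝ F (y 0))
    (hy : ∀ᶠ μ in 𝓝 (0 : ℝ), HasDerivAt y (F (y μ)) μ) :
    (fun μ => y μ - y 0 - μ • F (y 0)) =O[𝓝 0] fun μ : ℝ => μ ^ 2 := by
  have h0 := hy.self_of_nhds
  have h1 : (fun μ => F (y μ) - F (y 0)) =O[𝓝 0] fun μ : ℝ => μ ^ 1 := by
    have := (hF.hasFDerivAt.isBigO_sub.comp_tendsto h0.continuousAt.tendsto).trans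
      h0.hasFDerivAt.isBigO_sub
    simpa [Function.comp_def] using this
  have h2 := isBigO_sub_of_hasDerivAt (f := fun μ => y μ - μ • F (y 0))
    (f' := fun μ => F (y μ) - F (y 0))
    (by
      filter_upwards [hy] with μ hμ
      exact (hμ.sub ((hasDerivAt_id μ).smul_const (F (y 0)))).congr_deriv (by rw [one_smul])) h1
  refine h2.congr_left fun μ => ?_
  simp only [zero_smul, sub_zero]
  abel

/-- The product rule for expansions to first order with a remainder of second order. -/
lemma isBigO_expansion_mul {f g : ℝ → ℝ} {f₀ f₁ g₀ g₁ : ℝ}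
    (hf : (fun μ => f μ - f₀ - μ * f₁) =O[𝓝 0] fun μ : ℝ => μ ^ 2)
    (hg : (fun μ => g μ - g₀ - μ * g₁) =O[𝓝 0] fun μ : ℝ => μ ^ 2) :
    (fun μ => f μ * g μ - f₀ * g₀ - μ * (f₁ * g₀ + f₀ * g₁)) =O[𝓝 0] fun μ : ℝ => μ ^ 2 := by
  have hpoly : ∀ α β : ℝ, (fun μ : ℝ => α + μ * β) =O[𝓝 0] fun _ => (1 : ℝ) := fun α β =>
    ((by fun_prop : Continuous _).tendsto 0).isBigO_one ℝ
  have hsq : (fun μ : ℝ => μ ^ 2) =O[𝓝 0] fun _ => (1 : ℝ) :=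
    ((by fun_prop : Continuous _).tendsto 0).isBigO_one ℝ
  have hg1 : g =O[𝓝 0] fun _ => (1 : ℝ) := by
    refine ((hg.trans hsq).add (hpoly g₀ g₁)).congr_left fun μ => ?_
    ring
  have h1 := hf.mul hg1
  have h2 := (hpoly f₀ f₁).mul hg
  have h3 : (fun μ : ℝ => μ ^ 2 * (f₁ * g₁)) =O[𝓝 0] fun μ : ℝ => μ ^ 2 :=
    ((isBigO_refl (fun μ : ℝ => μ ^ 2) (𝓝 0)).const_mul_left (f₁ * g₁)).congr_left
      fun μ => mul_comm _ _
  simp only [mul_one, one_mul] at h1 h2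
  refine ((h1.add h2).add h3).congr_left fun μ => ?_
  ring

/-! ### The travel time of the beam -/

/-- Away from caustics the ray coordinates `(t, θ)` are local coordinates, so that the travel time
is well defined. -/
lemma isBeamTravelTime_localInverse {X : ℝ → ℝ → ℝ × ℝ} {t₀ θ₀ : ℝ}
    {L : (ℝ × ℝ) ≃L[ℝ] (ℝ × ℝ)}
    (hX : HasStrictFDerivAt (fun p : ℝ × ℝ => X p.1 p.2) (L : (ℝ × ℝ) →L[ℝ] (ℝ × ℝ)) (t₀, θ₀)) :
    IsBeamTravelTime X t₀ θ₀ (fun x => (hX.localInverse _ _ _ x).1) ∧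
      ∀ T, IsBeamTravelTime X t₀ θ₀ T →
        T =ᶠ[𝓝 (X t₀ θ₀)] fun x => (hX.localInverse _ _ _ x).1 := by
  refine ⟨hX.eventually_left_inverse.mono fun p hp => congrArg Prod.fst hp, fun T hT => ?_⟩
  filter_upwards [hX.localInverse_tendsto.eventually hT, hX.eventually_right_inverse] with x h1 h2
  rw [h2] at h1
  exact h1

/-- Along a curve through the beam, the travel time has as derivative the slowness of the beam
applied to the velocity of the curve. -/
lemma eventually_hasDerivAt_travelTime {Y : ℝ → ℝ → (ℝ × ℝ) × (ℝ × ℝ)}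
    {σ w p : ℝ → ℝ × ℝ} {p₀ : ℝ × ℝ}
    (heik : (fun q : (ℝ × ℝ) × (ℝ × ℝ) =>
        slowness c (Y q.2.1 q.2.2) ((Y q.1.1 q.1.2).1 - (Y q.2.1 q.2.2).1) - (q.1.1 - q.2.1))
      =O[𝓝 (p₀, p₀)] fun q => ‖q.1 - q.2‖ ^ 2)
    (hσ : ∀ᶠ μ in 𝓝 (0 : ℝ), HasDerivAt σ (w μ) μ)
    (hp : (fun m : ℝ × ℝ => p m.1 - p m.2) =O[𝓝 (0, 0)] fun m => m.1 - m.2)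
    (hp0 : Tendsto p (𝓝 0) (𝓝 p₀))
    (hYp : ∀ᶠ μ in 𝓝 (0 : ℝ), (Y (p μ).1 (p μ).2).1 = σ μ) :
    ∀ᶠ μ in 𝓝 (0 : ℝ),
      HasDerivAt (fun μ => (p μ).1) (slowness c (Y (p μ).1 (p μ).2) (w μ)) μ := by
  have htend : Tendsto (fun m : ℝ × ℝ => (p m.1, p m.2)) (𝓝 (0, 0)) (𝓝 (p₀, p₀)) := by
    rw [nhds_prod_eq, nhds_prod_eq]
    exact hp0.prodMap hp0
  have h1 : (fun m : ℝ × ℝ => slowness c (Y (p m.2).1 (p m.2).2)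
        ((Y (p m.1).1 (p m.1).2).1 - (Y (p m.2).1 (p m.2).2).1) - ((p m.1).1 - (p m.2).1))
      =O[𝓝 (0, 0)] fun m => ‖m.1 - m.2‖ ^ 2 :=
    (heik.comp_tendsto htend).trans (hp.norm_norm.pow 2)
  obtain ⟨C, hC⟩ := h1.bound
  have hYp2 : ∀ᶠ m : ℝ × ℝ in 𝓝 (0, 0), (Y (p m.1).1 (p m.1).2).1 = σ m.1 ∧
      (Y (p m.2).1 (p m.2).2).1 = σ m.2 :=
    ((continuous_fst.tendsto ((0 : ℝ), (0 : ℝ))).eventually hYp).and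
      ((continuous_snd.tendsto ((0 : ℝ), (0 : ℝ))).eventually hYp)
  have hdiag : Tendsto (fun μ : ℝ => (μ, μ)) (𝓝 0) (𝓝 ((0 : ℝ), (0 : ℝ))) :=
    (by fun_prop : Continuous fun μ : ℝ => (μ, μ)).tendsto 0
  filter_upwards [hdiag.eventually (hC.and hYp2).eventually_nhds, hσ] with μ hμ hσμ
  have hμ' : ∀ᶠ μ' in 𝓝 μ, ‖slowness c (Y (p μ).1 (p μ).2) (σ μ' - σ μ) - ((p μ').1 - (p μ).1)‖
      ≤ C * ‖‖μ' - μ‖ ^ 2‖ := by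
    have hslice : Tendsto (fun μ' : ℝ => (μ', μ)) (𝓝 μ) (𝓝 (μ, μ)) :=
      (by fun_prop : Continuous fun μ' : ℝ => (μ', μ)).tendsto μ
    filter_upwards [hslice.eventually hμ] with μ' h
    obtain ⟨h1, h2, h3⟩ := h
    rwa [h2, h3] at h1
  -- the travel time differs by a second-order term from a function with the asserted derivative
  have hlin : HasDerivAt (fun μ' => slowness c (Y (p μ).1 (p μ).2) (σ μ' - σ μ))
      (slowness c (Y (p μ).1 (p μ).2) (w μ)) μ := by
    have h1 : HasDerivAt (fun s => (σ s).1) (w μ).1 μ :=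
      (ContinuousLinearMap.fst ℝ ℝ ℝ).hasFDerivAt.comp_hasDerivAt μ hσμ
    have h2 : HasDerivAt (fun s => (σ s).2) (w μ).2 μ :=
      (ContinuousLinearMap.snd ℝ ℝ ℝ).hasFDerivAt.comp_hasDerivAt μ hσμ
    exact (((h1.sub_const _).const_mul _).add ((h2.sub_const _).const_mul _)).const_mul _
  rw [hasDerivAt_iff_isLittleO] at hlin ⊢
  have hsmall : (fun μ' => slowness c (Y (p μ).1 (p μ).2) (σ μ' - σ μ) - ((p μ').1 - (p μ).1))
      =o[𝓝 μ] fun μ' => μ' - μ := by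
    refine (IsBigO.of_bound C hμ').trans_isLittleO ?_
    exact isLittleO_pow_sub_sub μ one_lt_two
  refine (hlin.sub hsmall).congr_left fun μ' => ?_
  have h0 : slowness c (Y (p μ).1 (p μ).2) (σ μ - σ μ) = 0 := by simp [slowness]
  rw [h0]
  ring

/-- The vectors `c e` and `a c e^⊥` form a basis of the plane. -/
lemma exists_equiv_of_unit {c₀ a₀ : ℝ} {e : ℝ × ℝ} (hc₀ : c₀ ≠ 0) (ha₀ : a₀ ≠ 0)
    (he : e.1 ^ 2 + e.2 ^ 2 = 1) :
    ∃ L : (ℝ × ℝ) ≃L[ℝ] (ℝ × ℝ), ∀ v : ℝ × ℝ,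
      L v = v.1 • (c₀ * e.1, c₀ * e.2) + v.2 • (a₀ * c₀ * e.2, -(a₀ * c₀ * e.1)) := by
  let f : (ℝ × ℝ) →L[ℝ] ℝ × ℝ :=
    (ContinuousLinearMap.fst ℝ ℝ ℝ).smulRight (c₀ * e.1, c₀ * e.2)
      + (ContinuousLinearMap.snd ℝ ℝ ℝ).smulRight (a₀ * c₀ * e.2, -(a₀ * c₀ * e.1))
  let g : (ℝ × ℝ) →L[ℝ] ℝ × ℝ :=
    (ContinuousLinearMap.fst ℝ ℝ ℝ).smulRight (e.1 / c₀, e.2 / (a₀ * c₀))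
      + (ContinuousLinearMap.snd ℝ ℝ ℝ).smulRight (e.2 / c₀, -(e.1 / (a₀ * c₀)))
  refine ⟨ContinuousLinearEquiv.equivOfInverse f g (fun v => ?_) (fun v => ?_), fun v => rfl⟩
  · ext
    · simp only [f, g, add_apply, ContinuousLinearMap.smulRight_apply,
        ContinuousLinearMap.coe_fst', ContinuousLinearMap.coe_snd', Prod.smul_mk, Prod.mk_add_mk,
        smul_eq_mul]
      field_simp
      linear_combination v.1 * he
    · simp only [f, g, add_apply, ContinuousLinearMap.smulRight_apply,
        ContinuousLinearMap.coe_fst', ContinuousLinearMap.coe_snd', Prod.smul_mk, Prod.mk_add_mk,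
        smul_eq_mul]
      field_simp
      linear_combination v.2 * a₀ * he
  · ext
    · simp only [f, g, add_apply, ContinuousLinearMap.smulRight_apply,
        ContinuousLinearMap.coe_fst', ContinuousLinearMap.coe_snd', Prod.smul_mk, Prod.mk_add_mk,
        smul_eq_mul]
      field_simp
      linear_combination v.1 * he
    · simp only [f, g, add_apply, ContinuousLinearMap.smulRight_apply,
        ContinuousLinearMap.coe_fst', ContinuousLinearMap.coe_snd', Prod.smul_mk, Prod.mk_add_mk,
        smul_eq_mul]
      field_simp
      linear_combination v.2 * he

lemma isBigO_fst {α E₁ E₂ : Type*} [NormedAddCommGroup E₁] [NormedAddCommGroup E₂]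
    {f : α → E₁ × E₂} {g : α → ℝ} {l : Filter α} (h : f =O[l] g) :
    (fun x => (f x).1) =O[l] g :=
  (IsBigO.of_bound 1 (Eventually.of_forall fun x => by simpa using norm_fst_le (f x))).trans h

lemma isBigO_snd {α E₁ E₂ : Type*} [NormedAddCommGroup E₁] [NormedAddCommGroup E₂]
    {f : α → E₁ × E₂} {g : α → ℝ} {l : Filter α} (h : f =O[l] g) :
    (fun x => (f x).2) =O[l] g :=
  (IsBigO.of_bound 1 (Eventually.of_forall fun x => by simpa using norm_snd_le (f x))).trans h

/-- The slowness of the beam, applied to the velocity of a unit-speed geodesic that starts normally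
to the central ray, grows at the rate `b₀ / a₀`, where `a₀` and `b₀` are the values of `a` and `a'`.
Along the geodesic, the ray direction turns at the Euclidean rate `±(b₀ + a₀ c' e₂) / a₀` and the
geodesic itself at the rate `±c' e₂`; the difference is `±b₀ / a₀`. -/
lemma isBigO_slowness_sub {Y : ℝ → ℝ → (ℝ × ℝ) × (ℝ × ℝ)} {t₀ θ₀ a₀ b₀ : ℝ}
    {J₀ : (ℝ × ℝ) × (ℝ × ℝ)} {σ w p : ℝ → ℝ × ℝ} (hc₀ : c (Y t₀ θ₀).1.2 ≠ 0) (ha₀ : a₀ ≠ 0)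
    (hJ₀ : J₀ = jacobiField c (fun _ => Y t₀ θ₀) (fun _ => a₀) (fun _ => b₀) t₀)
    {L : (ℝ × ℝ) ≃L[ℝ] (ℝ × ℝ)}
    (hL : ∀ v : ℝ × ℝ, L v = v.1 • (phaseField c (Y t₀ θ₀)).1 + v.2 • J₀.1)
    (hunit : (Y t₀ θ₀).2.1 ^ 2 + (Y t₀ θ₀).2.2 ^ 2 = 1)
    (hY : (fun q : (ℝ × ℝ) × (ℝ × ℝ) => Y q.1.1 q.1.2 - Y q.2.1 q.2.2
        - ((q.1 - q.2).1 • phaseField c (Y t₀ θ₀) + (q.1 - q.2).2 • J₀))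
      =O[𝓝 ((t₀, θ₀), (t₀, θ₀))] fun q => ‖q - ((t₀, θ₀), (t₀, θ₀))‖ * ‖q.1 - q.2‖)
    (hF : DifferentiableAt ℝ (phaseField c) (toPhase c (σ 0) (w 0)))
    (hσ : ∀ᶠ μ in 𝓝 (0 : ℝ), HasDerivAt (fun μ => toPhase c (σ μ) (w μ))
      (phaseField c (toPhase c (σ μ) (w μ))) μ)
    (hσ₀ : σ 0 = (Y t₀ θ₀).1)
    (hp : (fun μ => p μ - (t₀, θ₀)) =O[𝓝 0] fun μ : ℝ => μ)
    (hYp : ∀ᶠ μ in 𝓝 (0 : ℝ), (Y (p μ).1 (p μ).2).1 = σ μ)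
    (hw : (toPhase c (σ 0) (w 0)).2.1 ^ 2 + (toPhase c (σ 0) (w 0)).2.2 ^ 2 = 1)
    (hnormal : (Y t₀ θ₀).2.1 * (toPhase c (σ 0) (w 0)).2.1
      + (Y t₀ θ₀).2.2 * (toPhase c (σ 0) (w 0)).2.2 = 0) :
    (fun μ => slowness c (Y (p μ).1 (p μ).2) (w μ) - b₀ / a₀ * μ) =O[𝓝 0]
      fun μ : ℝ => μ ^ 2 := by
  set e₁ := (Y t₀ θ₀).2.1 with he₁
  set e₂ := (Y t₀ θ₀).2.2 with he₂
  set f₁ := (toPhase c (σ 0) (w 0)).2.1 with hf₁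
  set f₂ := (toPhase c (σ 0) (w 0)).2.2 with hf₂
  -- the sign of the orientation of the geodesic relative to the ray
  set ε := e₂ * f₁ - e₁ * f₂ with hε
  have hf₁' : f₁ = ε * e₂ := by
    rw [hε]; linear_combination (-f₁) * hunit + e₁ * hnormal
  have hf₂' : f₂ = -(ε * e₁) := by
    rw [hε]; linear_combination (-f₂) * hunit + e₂ * hnormal
  have hε2 : ε ^ 2 = 1 := by
    have : ε ^ 2 * (e₁ ^ 2 + e₂ ^ 2) = 1 := by
      rw [hf₁', hf₂'] at hw
      linear_combination hw
    rwa [hunit, mul_one] at this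
  have hs := isBigO_sub_sub_of_integralCurve (y := fun μ => toPhase c (σ μ) (w μ)) hF hσ
  have hpt : Tendsto p (𝓝 0) (𝓝 (t₀, θ₀)) := by
    rw [← tendsto_sub_nhds_zero_iff]
    exact hp.trans_tendsto tendsto_id
  -- expansion of the beam in terms of its ray coordinates
  have h1 : (fun μ => Y (p μ).1 (p μ).2 - Y t₀ θ₀ - ((p μ - (t₀, θ₀)).1 • phaseField c (Y t₀ θ₀)
      + (p μ - (t₀, θ₀)).2 • J₀)) =O[𝓝 0] fun μ : ℝ => μ ^ 2 := by
    have htend : Tendsto (fun μ => (p μ, (t₀, θ₀))) (𝓝 0) (𝓝 ((t₀, θ₀), (t₀, θ₀))) :=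
      hpt.prodMk_nhds tendsto_const_nhds
    refine (hY.comp_tendsto htend).trans ?_
    have h := hp.norm_norm.mul hp.norm_norm
    refine IsBigO.trans (IsBigO.of_bound 1 (Eventually.of_forall fun μ => ?_))
      (h.trans (IsBigO.of_bound 1 (Eventually.of_forall fun μ => ?_)))
    · simp [Function.comp_apply, Prod.norm_def]
    · simp [pow_two]
  -- expansion of the ray coordinates of the geodesic
  have h2 : (fun μ => p μ - (t₀, θ₀) - μ • ((0, ε / a₀) : ℝ × ℝ)) =O[𝓝 0]
      fun μ : ℝ => μ ^ 2 := by
    have h3 : (fun μ => L (p μ - (t₀, θ₀) - μ • ((0, ε / a₀) : ℝ × ℝ))) =O[𝓝 0]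
        fun μ : ℝ => μ ^ 2 := by
      refine ((isBigO_fst hs).sub (isBigO_fst h1)).congr' ?_ EventuallyEq.rfl
      filter_upwards [hYp] with μ hμ
      rw [map_sub, map_smul, hL, hL]
      simp only [Prod.fst_sub, Prod.fst_add, Prod.smul_fst, hμ]
      have hw1 : (phaseField c (toPhase c (σ 0) (w 0))).1 = (ε / a₀) • J₀.1 := by
        rw [hJ₀]
        have hz : (toPhase c (σ 0) (w 0)).1.2 = (Y t₀ θ₀).1.2 := by
          rw [← hσ₀]; rfl
        simp only [phaseField, jacobiField, hz, ← hf₁, ← hf₂, ← he₁, ← he₂, Prod.smul_mk,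
          smul_eq_mul]
        rw [hf₁', hf₂']
        ext
        · simp only
          field_simp
        · simp only
          field_simp
      rw [hw1]
      have h0 : (toPhase c (σ μ) (w μ)).1 = σ μ := rfl
      have h0' : (toPhase c (σ 0) (w 0)).1 = σ 0 := rfl
      rw [h0, h0', hσ₀, zero_smul, zero_add]
      abel
    refine IsBigO.trans (IsBigO.of_bound ‖(L.symm : (ℝ × ℝ) →L[ℝ] (ℝ × ℝ))‖
      (Eventually.of_forall fun μ => ?_)) h3
    have := (L.symm : (ℝ × ℝ) →L[ℝ] (ℝ × ℝ)).le_opNorm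
      (L (p μ - (t₀, θ₀) - μ • ((0, ε / a₀) : ℝ × ℝ)))
    simpa only [ContinuousLinearEquiv.coe_coe, ContinuousLinearEquiv.symm_apply_apply] using this
  have h4 : (fun μ => Y (p μ).1 (p μ).2 - Y t₀ θ₀ - μ • ((ε / a₀) • J₀)) =O[𝓝 0]
      fun μ : ℝ => μ ^ 2 := by
    have ha := (isBigO_fst h2).smul (isBigO_refl (fun _ : ℝ => phaseField c (Y t₀ θ₀)) (𝓝 0))
    have hb := (isBigO_snd h2).smul (isBigO_refl (fun _ : ℝ => J₀) (𝓝 0))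
    have hk : ∀ v : (ℝ × ℝ) × (ℝ × ℝ), (fun μ : ℝ => μ ^ 2 • v) =O[𝓝 0] fun μ : ℝ => μ ^ 2 :=
      fun v => IsBigO.of_bound ‖v‖ (Eventually.of_forall fun μ => by
        rw [norm_smul, mul_comm])
    refine ((h1.add (ha.trans (hk _))).add (hb.trans (hk _))).congr_left fun μ => ?_
    simp only [Prod.fst_sub, Prod.snd_sub, Prod.smul_fst, Prod.smul_snd, sub_zero,
      smul_eq_mul, mul_zero]
    rw [sub_smul ((p μ).2 - θ₀), mul_smul]
    abel
  have hE1 := isBigO_fst (isBigO_snd h4)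
  have hE2 := isBigO_snd (isBigO_snd h4)
  have hS1 := isBigO_fst (isBigO_snd hs)
  have hS2 := isBigO_snd (isBigO_snd hs)
  simp only [Prod.fst_sub, Prod.snd_sub, Prod.smul_fst, Prod.smul_snd, smul_eq_mul]
    at hE1 hE2 hS1 hS2
  refine ((isBigO_expansion_mul hE1 hS1).add (isBigO_expansion_mul hE2 hS2)).congr' ?_
    EventuallyEq.rfl
  filter_upwards [hYp] with μ hμ
  have hz : (toPhase c (σ 0) (w 0)).1.2 = (Y t₀ θ₀).1.2 := by
    rw [← hσ₀]; rfl
  have hsl : slowness c (Y (p μ).1 (p μ).2) (w μ)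
      = (Y (p μ).1 (p μ).2).2.1 * (toPhase c (σ μ) (w μ)).2.1
        + (Y (p μ).1 (p μ).2).2.2 * (toPhase c (σ μ) (w μ)).2.2 := by
    simp only [slowness, toPhase, hμ]
    ring
  rw [hsl, hJ₀]
  simp only [jacobiField, phaseField, hz, ← hf₁, ← hf₂, ← he₁, ← he₂]
  generalize (Y (p μ).1 (p μ).2).2.1 * (toPhase c (σ μ) (w μ)).2.1 = P
  generalize (Y (p μ).1 (p μ).2).2.2 * (toPhase c (σ μ) (w μ)).2.2 = Q
  have hcoef : ε / a₀ * ((b₀ + a₀ * deriv c (Y t₀ θ₀).1.2 * e₂) * e₂) * f₁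
      + e₁ * (deriv c (Y t₀ θ₀).1.2 * (f₁ * f₂))
      + (ε / a₀ * -((b₀ + a₀ * deriv c (Y t₀ θ₀).1.2 * e₂) * e₁) * f₂
        + e₂ * -(deriv c (Y t₀ θ₀).1.2 * f₁ ^ 2)) = b₀ / a₀ := by
    have h5 : ε / a₀ * ((b₀ + a₀ * deriv c (Y t₀ θ₀).1.2 * e₂) * e₂) * f₁
      + ε / a₀ * -((b₀ + a₀ * deriv c (Y t₀ θ₀).1.2 * e₂) * e₁) * f₂
        = ε ^ 2 * (b₀ / a₀ + deriv c (Y t₀ θ₀).1.2 * e₂) := by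
      rw [hε]
      field_simp
      ring
    have h6 : e₁ * (deriv c (Y t₀ θ₀).1.2 * (f₁ * f₂)) + e₂ * -(deriv c (Y t₀ θ₀).1.2 * f₁ ^ 2)
        = -(deriv c (Y t₀ θ₀).1.2 * f₁ * ε) := by
      rw [hε]
      ring
    have h7 : f₁ * ε = e₂ := by
      rw [hf₁']
      linear_combination e₂ * hε2
    linear_combination h5 + h6 - deriv c (Y t₀ θ₀).1.2 * h7
      + (b₀ / a₀ + deriv c (Y t₀ θ₀).1.2 * e₂) * hε2
  linear_combination (-μ) * hcoef - hnormal

/-! ### The fan of rays -/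

/-- Strict differentiability with a quadratic remainder, used for the initial directions
`(cos θ, -sin θ)` of the rays. -/
lemma abs_sub_sub_mul_le_of_lipschitz_deriv {f f' : ℝ → ℝ} (hf : ∀ x, HasDerivAt f (f' x) x)
    (hf' : ∀ x y, |f' x - f' y| ≤ |x - y|) (θ₀ θ θ' : ℝ) :
    |f θ' - f θ - (θ' - θ) * f' θ₀| ≤ (|θ - θ₀| + |θ' - θ₀|) * |θ' - θ| := by
  set m := |θ - θ₀| + |θ' - θ₀| with hm
  have h := (convex_closedBall θ₀ m).norm_image_sub_le_of_norm_hasDerivWithin_le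
    (f := fun x => f x - x * f' θ₀) (f' := fun x => f' x - 1 * f' θ₀) (C := m) (x := θ) (y := θ')
    (fun x _ => ((hf x).sub ((hasDerivAt_id x).mul_const _)).hasDerivWithinAt)
    (fun x hx => by
      rw [one_mul]
      exact (hf' x θ₀).trans hx)
    (by rw [Metric.mem_closedBall, Real.dist_eq]; simp [hm])
    (by rw [Metric.mem_closedBall, Real.dist_eq]; simp [hm])
  calc _ = ‖f θ' - θ' * f' θ₀ - (f θ - θ * f' θ₀)‖ := by
        rw [Real.norm_eq_abs]; congr 1; ring
    _ ≤ _ := h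

variable {z₀ t₁ θ₀ : ℝ} {Θ : Set ℝ} {X V : ℝ → ℝ → ℝ × ℝ}

lemma IsRayFan.toPhase_zero (hX : IsRayFan c D z₀ t₁ Θ X V) (hz₀ : c z₀ ≠ 0) {θ : ℝ}
    (hθ : θ ∈ Θ) : toPhase c (X 0 θ) (V 0 θ) = ((0, z₀), (Real.cos θ, -Real.sin θ)) := by
  simp only [toPhase, hX.source θ hθ, hX.direction θ hθ]
  ext <;> simp [hz₀]

/-- The rays of the fan depend differentiably on the angle, and the derivative at the central ray
is the Jacobi field with normal component `a`. -/
lemma IsRayFan.exists_estimates (hD : IsOpen D) (hc : ContDiffOn ℝ 3 c D)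
    (hpos : ∀ z ∈ D, 0 < c z) (ht₁ : 0 ≤ t₁) (hΘ : Θ ∈ 𝓝 θ₀) (hX : IsRayFan c D z₀ t₁ Θ X V)
    {a a' : ℝ → ℝ} (ha : IsJacobiSolution c t₁ (fun t => X t θ₀) a a')
    (hunit : ∀ θ ∈ Θ, ∀ t ∈ Icc 0 t₁,
      (toPhase c (X t θ) (V t θ)).2.1 ^ 2 + (toPhase c (X t θ) (V t θ)).2.2 ^ 2 = 1)
    {J : ℝ → (ℝ × ℝ) × (ℝ × ℝ)}
    (hJ : J = jacobiField c (fun t => toPhase c (X t θ₀) (V t θ₀)) a a') :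
    ∃ C ≥ 0, ∃ r > 0, Metric.ball θ₀ r ⊆ Θ ∧
      ∀ θ ∈ Metric.ball θ₀ r, ∀ θ' ∈ Metric.ball θ₀ r, ∀ t ∈ Icc 0 t₁,
        ‖toPhase c (X t θ') (V t θ') - toPhase c (X t θ) (V t θ)‖ ≤ C * |θ' - θ| ∧
        ‖toPhase c (X t θ') (V t θ') - toPhase c (X t θ) (V t θ) - (θ' - θ) • J t‖
          ≤ C * (|θ - θ₀| + |θ' - θ₀|) * |θ' - θ| := by
  have hθ₀ := mem_of_mem_nhds hΘ
  have hz₀ : c z₀ ≠ 0 := by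
    have h := (hX.ray θ₀ hθ₀).mem 0 ⟨le_rfl, ht₁⟩
    simp only [hX.source θ₀ hθ₀] at h
    exact (hpos _ h).ne'
  refine exists_norm_sub_sub_smul_le (Y := fun t θ => toPhase c (X t θ) (V t θ))
    (isOpen_phaseDomain hD) (contDiffOn_phaseField hD hc) ht₁ hΘ
    (fun θ hθ t ht => (hX.ray θ hθ).hasDerivWithinAt_toPhase hD hc hpos ht)
    (fun t ht => (hX.ray θ₀ hθ₀).mem t ht)
    (fun t ht => ?_) ⟨1, fun θ hθ θ' hθ' => ?_⟩
  · rw [hJ]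
    exact hasDerivWithinAt_jacobiField hD hc
      ((hX.ray θ₀ hθ₀).hasDerivWithinAt_toPhase hD hc hpos ht) ((hX.ray θ₀ hθ₀).mem t ht)
      (hunit θ₀ hθ₀ t ht) (ha.hasDeriv t ht) (ha.hasDeriv' t ht)
  · have hJ0 : J 0 = ((0, 0), (-Real.sin θ₀, -Real.cos θ₀)) := by
      rw [hJ]
      simp [jacobiField, hX.toPhase_zero hz₀ hθ₀, ha.zero, ha.zero']
    have h1 := abs_sub_sub_mul_le_of_lipschitz_deriv Real.hasDerivAt_cos
      (fun x y => by
        rw [neg_sub_neg, abs_sub_comm x y]; exact Real.abs_sin_sub_sin_le y x) θ₀ θ θ'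
    have h2 := abs_sub_sub_mul_le_of_lipschitz_deriv Real.hasDerivAt_sin
      Real.abs_cos_sub_cos_le θ₀ θ θ'
    simp only [hX.toPhase_zero hz₀ hθ, hX.toPhase_zero hz₀ hθ', hJ0, one_mul]
    have h3 : (((0, z₀), (Real.cos θ', -Real.sin θ')) : (ℝ × ℝ) × (ℝ × ℝ))
        - ((0, z₀), (Real.cos θ, -Real.sin θ))
        - (θ' - θ) • (((0, 0), (-Real.sin θ₀, -Real.cos θ₀)) : (ℝ × ℝ) × (ℝ × ℝ))
        = ((0, 0), (Real.cos θ' - Real.cos θ - (θ' - θ) * -Real.sin θ₀,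
          -(Real.sin θ' - Real.sin θ - (θ' - θ) * Real.cos θ₀))) := by
      ext <;> simp
      ring
    rw [h3]
    refine max_le (max_le ?_ ?_) (max_le h1 ?_)
    · simp only [norm_zero]; positivity
    · simp only [norm_zero]; positivity
    · rw [norm_neg]; exact h2

end GaussianBeam

open GaussianBeam in
/-- Intrinsic transverse phase of a Gaussian beam in a horizontally stratified medium: near a
point of a ray that is not a caustic, the travel time of the beam is well defined, and along a
unit-speed geodesic `σ` normal to the ray it exceeds that of the wavefront by
`½ (ȧ/a) μ² + O(μ³)`. -/
theorem theorem3p7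
    (c : ℝ → ℝ) (D : Set ℝ) (hD : IsOpen D) (hc : ContDiffOn ℝ 3 c D) (hpos : ∀ z ∈ D, 0 < c z)
    (z₀ t₀ t₁ θ₀ : ℝ) (ht₀ : t₀ ∈ Ioo 0 t₁)
    (Θ : Set ℝ) (hΘ : Θ ∈ 𝓝 θ₀)
    (X V : ℝ → ℝ → ℝ × ℝ) (hX : GaussianBeam.IsRayFan c D z₀ t₁ Θ X V)
    (a a' : ℝ → ℝ) (ha : GaussianBeam.IsJacobiSolution c t₁ (fun t => X t θ₀) a a')
    (hcaustic : a t₀ ≠ 0)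
    (δ : ℝ) (hδ : 0 < δ) (σ w : ℝ → ℝ × ℝ)
    (hσ : GaussianBeam.IsFermatGeodesic c D (Ioo (-δ) δ) σ w)
    (hσ₀ : σ 0 = X t₀ θ₀)
    (hunit : GaussianBeam.fermat c (X t₀ θ₀) (w 0) (w 0) = 1)
    (hnormal : GaussianBeam.fermat c (X t₀ θ₀) (V t₀ θ₀) (w 0) = 0) :
    (∃ T, GaussianBeam.IsBeamTravelTime X t₀ θ₀ T ∧
      ∀ T', GaussianBeam.IsBeamTravelTime X t₀ θ₀ T' → T' =ᶠ[𝓝 (X t₀ θ₀)] T) ∧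
    ∀ T, GaussianBeam.IsBeamTravelTime X t₀ θ₀ T →
      (fun μ : ℝ => (T (σ μ) - t₀) - 1 / 2 * (a' t₀ / a t₀) * μ ^ 2)
        =O[𝓝 0] (fun μ : ℝ => μ ^ 3) := by
  have hθ₀ := mem_of_mem_nhds hΘ
  have ht₁ : 0 ≤ t₁ := (ht₀.1.trans ht₀.2).le
  have ht₀' : t₀ ∈ Icc 0 t₁ := Ioo_subset_Icc_self ht₀
  have hI : Icc 0 t₁ ∈ 𝓝 t₀ := Icc_mem_nhds ht₀.1 ht₀.2
  have hz₀ : c z₀ ≠ 0 := by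
    have h := (hX.ray θ₀ hθ₀).mem 0 ⟨le_rfl, ht₁⟩
    simp only [hX.source θ₀ hθ₀] at h
    exact (hpos _ h).ne'
  -- the fan of rays in phase space
  set Y : ℝ → ℝ → (ℝ × ℝ) × (ℝ × ℝ) := fun t θ => toPhase c (X t θ) (V t θ) with hYdef
  have hYd : ∀ θ ∈ Θ, ∀ t ∈ Icc 0 t₁,
      HasDerivWithinAt (fun t => Y t θ) (phaseField c (Y t θ)) (Icc 0 t₁) t :=
    fun θ hθ t ht => (hX.ray θ hθ).hasDerivWithinAt_toPhase hD hc hpos ht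
  have hYD : ∀ θ ∈ Θ, ∀ t ∈ Icc 0 t₁, (Y t θ).1.2 ∈ D := fun θ hθ t ht => (hX.ray θ hθ).mem t ht
  have hYunit : ∀ θ ∈ Θ, ∀ t ∈ Icc 0 t₁, (Y t θ).2.1 ^ 2 + (Y t θ).2.2 ^ 2 = 1 := by
    intro θ hθ t ht
    have h0 : Y 0 θ = ((0, z₀), (Real.cos θ, -Real.sin θ)) := hX.toPhase_zero hz₀ hθ
    rw [sq_add_sq_eq_of_solution (hYd θ hθ) t ht, h0]
    simp
  set J := jacobiField c (fun t => Y t θ₀) a a' with hJ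
  obtain ⟨C, hC, r, hr, hrΘ, hest⟩ := hX.exists_estimates hD hc hpos ht₁ hΘ ha hYunit hJ
  have hFd : ∀ y : (ℝ × ℝ) × (ℝ × ℝ), y.1.2 ∈ D → DifferentiableAt ℝ (phaseField c) y :=
    fun y hy => ((contDiffOn_phaseField hD hc).differentiableOn (by norm_num)).differentiableAt
      ((isOpen_phaseDomain hD).mem_nhds hy)
  have hD₀ := hYD θ₀ hθ₀ t₀ ht₀'
  have hc₀ : c (Y t₀ θ₀).1.2 ≠ 0 := (hpos _ hD₀).ne'
  have hYO := isBigO_sub_sub_of_solutions (Y := Y) ht₀ hr (hFd _ hD₀)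
    (fun θ hθ => hYd θ (hrΘ hθ))
    ((hasDerivWithinAt_jacobiField hD hc (hYd θ₀ hθ₀ t₀ ht₀') hD₀ (hYunit θ₀ hθ₀ t₀ ht₀')
      (ha.hasDeriv t₀ ht₀') (ha.hasDeriv' t₀ ht₀')).hasDerivAt hI) hest
  -- strict differentiability of the fan at `(t₀, θ₀)`
  let L' : (ℝ × ℝ) →L[ℝ] (ℝ × ℝ) × (ℝ × ℝ) :=
    (ContinuousLinearMap.fst ℝ ℝ ℝ).smulRight (phaseField c (Y t₀ θ₀))
      + (ContinuousLinearMap.snd ℝ ℝ ℝ).smulRight (J t₀)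
  have hYs : HasStrictFDerivAt (fun p : ℝ × ℝ => Y p.1 p.2) L' (t₀, θ₀) := by
    rw [hasStrictFDerivAt_iff_isLittleO]
    refine IsBigO.trans_isLittleO hYO ?_
    have h1 : (fun q : (ℝ × ℝ) × (ℝ × ℝ) => ‖q - ((t₀, θ₀), (t₀, θ₀))‖)
        =o[𝓝 ((t₀, θ₀), (t₀, θ₀))] fun _ => (1 : ℝ) := by
      rw [isLittleO_one_iff]
      exact tendsto_norm_sub_self _
    have h2 := h1.mul_isBigO (isBigO_refl (fun q : (ℝ × ℝ) × (ℝ × ℝ) => ‖q.1 - q.2‖) _)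
    simpa using h2
  obtain ⟨L, hL⟩ := exists_equiv_of_unit (e := (Y t₀ θ₀).2) hc₀ hcaustic (hYunit θ₀ hθ₀ t₀ ht₀')
  have hXs : HasStrictFDerivAt (fun p : ℝ × ℝ => X p.1 p.2) (L : (ℝ × ℝ) →L[ℝ] (ℝ × ℝ))
      (t₀, θ₀) := by
    have h := hYs.fst
    refine h.congr_fderiv ?_
    refine ContinuousLinearMap.ext fun v => ?_
    exact (hL v).symm
  obtain ⟨hT₀, huniq⟩ := isBeamTravelTime_localInverse hXs
  refine ⟨⟨_, hT₀, huniq⟩, fun T hT => ?_⟩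
  -- the geodesic `σ` in phase space and in ray coordinates
  have hIσ : ∀ᶠ μ in 𝓝 (0 : ℝ), Ioo (-δ) δ ∈ 𝓝 μ :=
    (Ioo_mem_nhds (by linarith) hδ : Ioo (-δ) δ ∈ 𝓝 0) |> eventually_mem_nhds_iff.2
  have hσd : ∀ᶠ μ in 𝓝 (0 : ℝ), HasDerivAt σ (w μ) μ :=
    hIσ.mono fun μ hμ => (hσ.velocity μ (mem_of_mem_nhds hμ)).hasDerivAt hμ
  have hσp : ∀ᶠ μ in 𝓝 (0 : ℝ), HasDerivAt (fun μ => toPhase c (σ μ) (w μ))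
      (phaseField c (toPhase c (σ μ) (w μ))) μ :=
    hIσ.mono fun μ hμ =>
      (hσ.hasDerivWithinAt_toPhase hD hc hpos (mem_of_mem_nhds hμ)).hasDerivAt hμ
  have hwcont : ContinuousAt w 0 :=
    ((hσ.acceleration 0 (mem_of_mem_nhds hIσ.self_of_nhds)).hasDerivAt
      hIσ.self_of_nhds).continuousAt
  have hσs : HasStrictDerivAt σ (w 0) 0 := hasStrictDerivAt_of_hasDerivAt_of_continuousAt hσd hwcont
  set g := hXs.localInverse (fun p : ℝ × ℝ => X p.1 p.2) L (t₀, θ₀) with hg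
  have hgX : g (X t₀ θ₀) = (t₀, θ₀) := hXs.localInverse_apply_image
  have hσt : Tendsto σ (𝓝 0) (𝓝 (X t₀ θ₀)) := hσ₀ ▸ hσs.hasDerivAt.continuousAt.tendsto
  set p : ℝ → ℝ × ℝ := fun μ => g (σ μ) with hp
  have hp0 : p 0 = (t₀, θ₀) := by rw [hp]; simp only [hσ₀]; exact hgX
  have hpt : Tendsto p (𝓝 0) (𝓝 (t₀, θ₀)) := hXs.localInverse_tendsto.comp hσt
  have hpO : (fun m : ℝ × ℝ => p m.1 - p m.2) =O[𝓝 (0, 0)] fun m => m.1 - m.2 := by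
    have h2 : Tendsto (fun m : ℝ × ℝ => (σ m.1, σ m.2)) (𝓝 (0, 0))
        (𝓝 (X t₀ θ₀, X t₀ θ₀)) := by
      rw [nhds_prod_eq, nhds_prod_eq]
      exact hσt.prodMap hσt
    exact (hXs.to_localInverse.isBigO_sub.comp_tendsto h2).trans hσs.hasStrictFDerivAt.isBigO_sub
  have hpO' : (fun μ => p μ - (t₀, θ₀)) =O[𝓝 0] fun μ : ℝ => μ := by
    have h : Tendsto (fun μ : ℝ => (μ, (0 : ℝ))) (𝓝 0) (𝓝 (0, 0)) :=
      (by fun_prop : Continuous fun μ : ℝ => (μ, (0 : ℝ))).tendsto 0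
    have h2 := hpO.comp_tendsto h
    simpa [Function.comp_def, hp0] using h2
  have hYp : ∀ᶠ μ in 𝓝 (0 : ℝ), (Y (p μ).1 (p μ).2).1 = σ μ :=
    hσt.eventually hXs.eventually_right_inverse
  -- the travel time along `σ` and its derivative
  have heik := isBigO_slowness_sub_sub hD hc hpos ht₀ hr hC (fun θ hθ => hYd θ (hrΘ hθ))
    (fun θ hθ => hYD θ (hrΘ hθ)) (fun θ hθ => hYunit θ (hrΘ hθ))
    (fun θ hθ => (hX.source θ (hrΘ hθ)).trans (hX.source θ₀ hθ₀).symm)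
    (fun θ hθ θ' hθ' t ht => (hest θ hθ θ' hθ' t ht).1) hYs.isBigO_sub
  have hτ := eventually_hasDerivAt_travelTime heik hσd hpO hpt hYp
  have hDσ : (σ 0).2 ∈ D := hσ.mem 0 (mem_of_mem_nhds hIσ.self_of_nhds)
  have hslow := isBigO_slowness_sub (Y := Y) (b₀ := a' t₀) (J₀ := J t₀) (L := L) hc₀ hcaustic rfl hL
    (hYunit θ₀ hθ₀ t₀ ht₀') hYO (hFd _ hDσ) hσp hσ₀ hpO' hYp
    (by
      refine Eq.trans ?_ hunit
      simp only [toPhase, fermat, hσ₀]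
      ring)
    (by
      refine Eq.trans ?_ hnormal
      simp only [hYdef, toPhase, fermat, hσ₀]
      ring)
  have hfin := isBigO_sub_of_hasDerivAt
    (f := fun μ => (p μ).1 - 1 / 2 * (a' t₀ / a t₀) * μ ^ 2)
    (f' := fun μ => slowness c (Y (p μ).1 (p μ).2) (w μ) - a' t₀ / a t₀ * μ)
    (by
      filter_upwards [hτ] with μ hμ
      refine (hμ.sub ((hasDerivAt_pow 2 μ).const_mul _)).congr_deriv ?_
      push_cast
      ring) hslow
  refine hfin.congr' ?_ EventuallyEq.rfl
  filter_upwards [hσt.eventually (huniq T hT)] with μ hμ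
  rw [hμ, hp0]
  simp only [hp, hg]
  ring
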